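/- Let $Y_1,Y_2,\dots$ be i.i.d. random elements of $L^2([0,1])$ with $E\,Y_i=0$ and $E\|Y_i\|^2<\infty$, and let $c(t,s)=E[Y_i(t)Y_i(s)]\in L^2([0,1]^2)$ be their covariance kernel. Let $\theta\in(0,1)$, $\mu_1,\mu_2\in L^2([0,1])$, $\Delta=\mu_1-\mu_2$. For each sample size $N$ the observations $X_1,\dots,X_N$ are $X_i=\mu_1+Y_i$ for $i\le k^*$ and $X_i=\mu_2+Y_i$ for $k^*<i\le N$, where $k^*=\lfloor N\theta\rfloor$. For $u\in(0,1]$ and $k=\lfloor Nu\rfloor$ let $$\widehat c_u(t,s)=\frac1N\Big[\sum_{i=1}^{k}(X_i(t)-\widehat\mu_k(t))(X_i(s)-\widehat\mu_k(s))+\sum_{i=k+1}^{N}(X_i(t)-\widetilde\mu_k(t))(X_i(s)-\widetilde\mu_k(s))\Big],$$ where $\widehat\mu_k$ and $\widetilde\mu_k$ are the averages of $X_1,\dots,X_k$ and of $X_{k+1},\dots,X_N$ (an empty sum is $0$), and let $$c_u(t,s)=c(t,s)+\theta(1-\theta)f_\theta(u)\Delta(t)\Delta(s),\qquad f_\theta(u)=\frac{\max\{u,\theta\}-\min\{u,\theta\}}{\max\{u,\theta\}(1-\min\{u,\theta\})}.$$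 Fix $d$ such that the $d$ largest eigenvalues (with multiplicity) of the integral operator with kernel $c$ are positive. For $u\in(0,1]$ let $\gamma_u^1\ge\dots\ge\gamma_u^d$ be the $d$ largest eigenvalues (with multiplicity) of the integral operator with kernel $c_u$, with orthonormal eigenfunctions $\omega_u^1,\dots,\omega_u^d$, and let $\widehat\lambda_u^l,\widehat\upsilon_u^l$ ($1\le l\le d$) be the same for $\widehat c_u$; any choice of the eigenfunctions is allowed. Put $\widehat\eta_{i,l}(u)=\int_0^1X_i(t)\widehat\upsilon_u^l(t)\,dt$ and $$H_{N,d}=\frac1{N^2}\sum_{l=1}^d\sum_{k=1}^N\frac1{\widehat\lambda_{k/N}^l}\Big(\sum_{i=1}^k\widehat\eta_{i,l}(k/N)-\frac kN\sum_{i=1}^N\widehat\eta_{i,l}(k/N)\Big)^2 ,$$ where $1/0$ is read as $0$, and $$g_l(u)=\min\{\theta,u\}\,(1-\max\{\theta,u\})\int_0^1\Delta(t)\,\omega_u^l(t)\,dt .$$ Then each $u\mapsto g_l^2(u)/\gamma_u^l$ is integrable on $[0,1]$ and, as $N\to\infty$, $$\frac1N H_{N,d}\xrightarrow{P}\sum_{l=1}^d\int_0^1\frac{g_l^2(u)}{\gamma_u^l}\,du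 .$$ Moreover, if this limit is positive, then $H_{N,d}\xrightarrow{P}\infty$, that is, $P(H_{N,d}\le M)\to0$ for every real $M$. -/

import Mathlib

open MeasureTheory ProbabilityTheory Filter Topology

noncomputable section

/-- The Hilbert space `L²([0,1])`. -/
abbrev L2I : Type := Lp ℝ 2 (volume : Measure unitInterval)

/-- The space `L²([0,1] × [0,1])` of square-integrable kernels. -/
abbrev L2II : Type := Lp ℝ 2 (volume : Measure (unitInterval × unitInterval))

theorem memLp_tensor (x y : L2I) :
    MemLp (fun p : unitInterval × unitInterval => x p.1 * y p.2) 2 volume := by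
  have hx := Lp.memLp x
  have hy := Lp.memLp y
  have hm : AEStronglyMeasurable
      (fun p : unitInterval × unitInterval => x p.1 * y p.2) volume :=
    (hx.1.comp_fst).mul (hy.1.comp_snd)
  rw [memLp_two_iff_integrable_sq hm]
  have h := ((memLp_two_iff_integrable_sq hx.1).1 hx).mul_prod
    ((memLp_two_iff_integrable_sq hy.1).1 hy)
  refine h.congr (Eventually.of_forall fun p => ?_)
  simp only [mul_pow]

/-- The kernel `(t, s) ↦ x(t) y(s)`. -/
def tensorKernel (x y : L2I) : L2II := (memLp_tensor x y).toLp _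

/-- The covariance kernel `c(t, s) = E(Y(t) Y(s))` of a centred random element `Y` of `L²([0,1])`,
the expectation being taken in `L²([0,1] × [0,1])`. -/
def covKernel {Ω : Type*} [MeasurableSpace Ω] (P : Measure Ω) (Y : Ω → L2I) : L2II :=
  ∫ ω, tensorKernel (Y ω) (Y ω) ∂P

/-- `γ 0 ≥ ⋯ ≥ γ (d-1)` are the `d` largest eigenvalues, counted with multiplicity, of the integral
operator `φ ↦ ∫ K(·, s) φ(s) ds` and `φ 0, …, φ (d-1)` are corresponding orthonormal
eigenfunctions. -/
structure IsLeadingEigensystem {d : ℕ} (K : L2II) (γ : Fin d → ℝ) (φ : Fin d → L2I) : Prop where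
  orthonormal : Orthonormal ℝ φ
  eigen : ∀ l, ∀ᵐ t : unitInterval, ∫ s : unitInterval, K (t, s) * φ l s = γ l * φ l t
  antitone : Antitone γ
  largest : ∀ (ψ : L2I) (c : ℝ), ψ ≠ 0 → (∀ l, ∫ t : unitInterval, φ l t * ψ t = 0) →
    (∀ᵐ t : unitInterval, ∫ s : unitInterval, K (t, s) * ψ s = c * ψ t) → ∀ l, c ≤ γ l

/-- The sample of size `N` with at most one change, at `k* = ⌊N θ⌋`. Indices start at `0`:
the value at `i` is the `(i+1)`-st observation, with mean `μ₁` if `i + 1 ≤ k*`, else `μ₂`. -/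
def changeSample {Ω : Type*} (θ : ℝ) (μ₁ μ₂ : L2I) (Y : ℕ → Ω → L2I) (N : ℕ) (ω : Ω) (i : ℕ) :
    L2I :=
  (if i < ⌊(N : ℝ) * θ⌋₊ then μ₁ else μ₂) + Y i ω

/-- The average of the observations with index in `s`. -/
def segmentMean (s : Finset ℕ) (x : ℕ → L2I) : L2I := (s.card : ℝ)⁻¹ • ∑ i ∈ s, x i

/-- The kernel `∑_{i ∈ s} (x_i(t) - x̄(t)) (x_i(s) - x̄(s))` with `x̄` the average over `s`. -/
def segmentScatter (s : Finset ℕ) (x : ℕ → L2I) : L2II :=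
  ∑ i ∈ s, tensorKernel (x i - segmentMean s x) (x i - segmentMean s x)

/-- The covariance estimator `ĉ_u` of the sample `x_0, …, x_{N-1}`: the sample is split after the
first `k = ⌊N u⌋` observations and each part is centred at its own mean. -/
def covEstimator (N : ℕ) (x : ℕ → L2I) (u : ℝ) : L2II :=
  (N : ℝ)⁻¹ • (segmentScatter (Finset.range ⌊(N : ℝ) * u⌋₊) x
    + segmentScatter (Finset.Ico ⌊(N : ℝ) * u⌋₊ N) x)

/-- The function `f_θ(u)`. -/
def changeWeight (θ u : ℝ) : ℝ := (max u θ - min u θ) / (max u θ * (1 - min u θ))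

/-- The kernel `c_u(t, s) = c(t, s) + θ (1 - θ) Δ(t) Δ(s) f_θ(u)`. -/
def limitKernel (c : L2II) (θ : ℝ) (Δ : L2I) (u : ℝ) : L2II :=
  c + (θ * (1 - θ) * changeWeight θ u) • tensorKernel Δ Δ

/-- The function `g_l(u) = min(θ, u) (1 - max(θ, u)) ∫ Δ(t) w(t) dt` for `w = ω_u^l`. -/
def driftCoeff (θ u : ℝ) (Δ w : L2I) : ℝ :=
  min θ u * (1 - max θ u) * ∫ t : unitInterval, Δ t * w t

/-- The noncentral score `∫ x(t) v(t) dt`. -/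
def score (x v : L2I) : ℝ := ∫ t : unitInterval, x t * v t

/-- The test statistic `H_{N,d}` of the sample `x_0, …, x_{N-1}`, computed from the estimated
eigenvalues `lamHat u l` and eigenfunctions `vHat u l`; the sum is over `u = k / N` with
`k = 1, …, N`. -/
def testStat {d : ℕ} (N : ℕ) (x : ℕ → L2I) (lamHat : ℝ → Fin d → ℝ) (vHat : ℝ → Fin d → L2I) :
    ℝ :=
  1 / (N : ℝ) ^ 2 * ∑ l : Fin d, ∑ k ∈ Finset.Icc 1 N,
    1 / lamHat ((k : ℝ) / N) l *
      (∑ i ∈ Finset.range k, score (x i) (vHat ((k : ℝ) / N) l)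
        - (k : ℝ) / N * ∑ i ∈ Finset.range N, score (x i) (vHat ((k : ℝ) / N) l)) ^ 2

end

/-! Let `T_k = N⁻¹ (∑_{i<k} X_i - (k/N) ∑_{i<N} X_i)`. Then `H_{N,d} / N` is the average over `k` of
the sums over `l` of `⟪T_k, v̂_l⟫² / λ̂_l`, taken at `u = k/N`. This is a Riemann sum. It converges
as soon as, uniformly in `k`, `T_k` is close to `min(θ,u) (1 - max(θ,u)) Δ` and the operator of
`ĉ_u` is close in norm to that of `c_u`.

Uniform closeness. Comparing within-segment and total scatter gives `ĉ_u = (total scatter)/N - T_k ⊗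
T_k / (u(1-u))`, and `c_u` has the same form (`changeWeight_eq_sub`). The factor `1/(u(1-u))` is
singular at the ends. The deterministic part of `T_k` is bounded by a multiple of `u(1-u)`, and
strong laws for `Y_i`, `‖Y_i‖²` and `Y_i ⊗ Y_i` give a squared noise part at most `ε u(1-u)` for all
`k` at once (`eventually_norm_contrast_sq_le`).

From operators to scores. Eigenvalues converge by min-max, but eigenfunctions need not, since
eigenvalues may be multiple. It suffices that `⟪Δ, x⟫²` takes one value on all unit eigenvectors `x`
of `c_u` with a given eigenvalue; compactness then gives convergence of the squared scores
(`tendsto_inner_sq_eigenvector`). As `c_u` is a rank one perturbation of `c` along `Δ`, this fails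
for at most countably many `u` (`countable_setOf_inner_sq_ne`). Dominated convergence finishes,
because the eigenvalues of `c_u` dominate the positive ones of `c`.

The eigenfunctions are arbitrary choices, possibly not measurable in `ω`. So the passage from
closeness to the Riemann sum is deterministic (`exists_uniform_average_close`), and probability
enters only through the event `deviationSet`, which does not involve eigenfunctions. -/

noncomputable section

open InnerProductSpace

/-! ### Min-max for leading eigenvalues, and stability of squared eigenvector coefficients. -/

section Spectral

variable {H : Type*} [NormedAddCommGroup H] [InnerProductSpace ℝ H]

/-- `γ 0 ≥ ⋯ ≥ γ (d-1)` are the `d` largest eigenvalues, counted with multiplicity, of the bounded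
operator `A`, and `φ 0, …, φ (d-1)` are corresponding orthonormal eigenvectors. -/
structure HasLeadingEigensystem {d : ℕ} (A : H →L[ℝ] H) (γ : Fin d → ℝ) (φ : Fin d → H) :
    Prop where
  orthonormal : Orthonormal ℝ φ
  eigen : ∀ l, A (φ l) = γ l • φ l
  antitone : Antitone γ
  largest : ∀ (ψ : H) (c : ℝ), ψ ≠ 0 → (∀ l, inner ℝ (φ l) ψ = 0) → A ψ = c • ψ → ∀ l, c ≤ γ l

/-- Eigenvectors for distinct eigenvalues are orthogonal, so the quadratic form is diagonal on
finite sums of eigenvectors. -/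
theorem inner_apply_self_le_of_mem_iSup_eigenspace {B : H →ₗ[ℝ] H} (hB : B.IsSymmetric) {m : ℝ}
    (hm : ∀ (μ : ℝ) (ψ : H), ψ ≠ 0 → B ψ = μ • ψ → μ ≤ m) {x : H}
    (hx : x ∈ ⨆ μ, Module.End.eigenspace B μ) : inner ℝ (B x) x ≤ m * ‖x‖ ^ 2 := by
  obtain ⟨f, hf, rfl⟩ := (Submodule.mem_iSup_iff_exists_finsupp _ _).1 hx
  have hBf : ∀ μ, B (f μ) = μ • f μ := fun μ => Module.End.mem_eigenspace_iff.1 (hf μ)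
  have horth : ∀ μ ν, μ ≠ ν → inner ℝ (f μ) (f ν) = 0 := by
    intro μ ν hne
    have h := hB (f μ) (f ν)
    rw [hBf, hBf, inner_smul_left, inner_smul_right] at h
    have : (μ - ν) * inner ℝ (f μ) (f ν) = 0 := by
      simp only [conj_trivial] at h; linarith
    exact (mul_eq_zero.1 this).resolve_left (sub_ne_zero.2 hne)
  -- Used with `c = 1` for the squared norm and with `c μ = μ` for the quadratic form.
  have hinner : ∀ c : ℝ → ℝ, inner ℝ (∑ μ ∈ f.support, c μ • f μ) (∑ μ ∈ f.support, f μ)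
      = ∑ μ ∈ f.support, c μ * ‖f μ‖ ^ 2 := by
    intro c
    rw [sum_inner]
    refine Finset.sum_congr rfl fun μ hμ => ?_
    rw [inner_sum, Finset.sum_eq_single μ]
    · rw [inner_smul_left, real_inner_self_eq_norm_sq, conj_trivial]
    · intro ν _ hne
      rw [inner_smul_left, horth μ ν hne.symm, mul_zero]
    · exact fun h => absurd hμ h
  have h1 := hinner (fun _ => 1)
  have h2 := hinner (fun μ => μ)
  simp only [one_smul, one_mul, real_inner_self_eq_norm_sq] at h1
  simp only [Finsupp.sum, map_sum, hBf]
  rw [h2, h1, Finset.mul_sum]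
  refine Finset.sum_le_sum fun μ _ => ?_
  by_cases h0 : f μ = 0
  · simp [h0]
  · exact mul_le_mul_of_nonneg_right (hm μ _ h0 (hBf μ)) (sq_nonneg _)

/-- By the spectral theorem the eigenspaces of a compact symmetric operator span a dense subspace,
and the inequality is a closed condition. -/
theorem inner_apply_self_le_of_eigenvalue_le [CompleteSpace H] {B : H →L[ℝ] H}
    (hc : IsCompactOperator B) (hB : (B : H →ₗ[ℝ] H).IsSymmetric) {m : ℝ}
    (hm : ∀ (μ : ℝ) (ψ : H), ψ ≠ 0 → B ψ = μ • ψ → μ ≤ m) (x : H) :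
    inner ℝ (B x) x ≤ m * ‖x‖ ^ 2 := by
  have hd := ContinuousLinearMap.orthogonalComplement_iSup_eigenspaces_eq_bot hc hB
  rw [← Submodule.topologicalClosure_eq_top_iff] at hd
  have hx : x ∈ closure ((⨆ μ, Module.End.eigenspace (B : H →ₗ[ℝ] H) μ : Submodule ℝ H) : Set H) := by
    rw [← Submodule.topologicalClosure_coe, hd]; trivial
  have hclosed : IsClosed {y : H | inner ℝ (B y) y ≤ m * ‖y‖ ^ 2} :=
    isClosed_le (by fun_prop) (by fun_prop)
  exact closure_minimal (fun y hy => inner_apply_self_le_of_mem_iSup_eigenspace hB hm hy) hclosed hx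

variable {d : ℕ} {A B : H →L[ℝ] H} {γ γ' : Fin d → ℝ} {φ φ' : Fin d → H}

namespace HasLeadingEigensystem

/-- The orthogonal complement of the `φ j` is invariant, and `largest` bounds every eigenvalue of
the restriction by each `γ l`. -/
theorem inner_apply_self_le_of_orthogonal [CompleteSpace H] (h : HasLeadingEigensystem A γ φ)
    (hc : IsCompactOperator A) (hA : (A : H →ₗ[ℝ] H).IsSymmetric) {x : H}
    (hx : ∀ l, inner ℝ (φ l) x = 0) (l : Fin d) : inner ℝ (A x) x ≤ γ l * ‖x‖ ^ 2 := by
  let V : Submodule ℝ H := ⨅ j, (innerSL ℝ (φ j)).ker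
  have hVmem : ∀ y, y ∈ V ↔ ∀ j, inner ℝ (φ j) y = 0 := by
    intro y; simp [V, Submodule.mem_iInf]
  have hVc : IsClosed (V : Set H) := by
    have : (V : Set H) = ⋂ j, {y | inner ℝ (φ j) y = 0} := by
      ext y; simp [hVmem]
    rw [this]
    exact isClosed_iInter fun j => isClosed_eq (by fun_prop) continuous_const
  have : CompleteSpace V := hVc.completeSpace_coe
  have hinv : ∀ y ∈ V, (A : H →ₗ[ℝ] H) y ∈ V := by
    intro y hy
    rw [hVmem] at hy ⊢
    intro j
    have := hA (φ j) y
    simp only [ContinuousLinearMap.coe_coe] at this ⊢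
    rw [← this, h.eigen, inner_smul_left, hy, mul_zero]
  let C : V →L[ℝ] V := ⟨(A : H →ₗ[ℝ] H).restrict hinv,
    by
      refine Continuous.subtype_mk (f := fun y : V => A y) ?_ _
      fun_prop⟩
  have hCc : IsCompactOperator C := IsCompactOperator.restrict hc hinv hVc
  have hCs : (C : V →ₗ[ℝ] V).IsSymmetric := hA.restrict_invariant hinv
  have hCapp : ∀ y : V, (C y : H) = A y := fun y => rfl
  have := inner_apply_self_le_of_eigenvalue_le hCc hCs (m := γ l) ?_ ⟨x, (hVmem x).2 hx⟩
  · exact this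
  · intro μ ψ hψ hCψ
    refine h.largest ψ μ (by simpa using hψ) ((hVmem _).1 ψ.2) ?_ l
    rw [← hCapp, hCψ]; rfl

/-- Upper half of min-max. The span of the `φ j` and its complement are both invariant, so the form
splits without cross terms; on the span only indices `j ≥ l` contribute. -/
theorem inner_apply_self_le [CompleteSpace H] (h : HasLeadingEigensystem A γ φ)
    (hc : IsCompactOperator A) (hA : (A : H →ₗ[ℝ] H).IsSymmetric) {x : H} {l : Fin d}
    (hx : ∀ j < l, inner ℝ (φ j) x = 0) : inner ℝ (A x) x ≤ γ l * ‖x‖ ^ 2 := by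
  set p : H := ∑ j, inner ℝ (φ j) x • φ j with hp
  set y := x - p with hy
  have hφp : ∀ j, inner ℝ (φ j) p = inner ℝ (φ j) x := by
    intro j
    rw [hp, h.orthonormal.inner_right_fintype]
  have hφy : ∀ j, inner ℝ (φ j) y = 0 := by
    intro j; rw [hy, inner_sub_right, hφp, sub_self]
  have hpy : inner ℝ p y = 0 := by
    rw [hp, sum_inner]
    exact Finset.sum_eq_zero fun j _ => by rw [inner_smul_left, hφy, mul_zero]
  have hAp : A p = ∑ j, (inner ℝ (φ j) x * γ j) • φ j := by
    rw [hp, map_sum]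
    exact Finset.sum_congr rfl fun j _ => by rw [map_smul, h.eigen, smul_smul]
  have hApy : inner ℝ (A p) y = 0 := by
    rw [hAp, sum_inner]
    exact Finset.sum_eq_zero fun j _ => by rw [inner_smul_left, hφy, mul_zero]
  have hAyp : inner ℝ (A y) p = 0 := by
    have := hA y p
    simp only [ContinuousLinearMap.coe_coe] at this
    rw [this, real_inner_comm, hApy]
  have hxpy : x = p + y := by rw [hy]; abel
  have hpp : ‖p‖ ^ 2 = ∑ j, inner ℝ (φ j) x ^ 2 := by
    rw [← real_inner_self_eq_norm_sq]
    nth_rewrite 1 [hp]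
    rw [sum_inner]
    exact Finset.sum_congr rfl fun j _ => by
      rw [inner_smul_left, hφp, conj_trivial, sq]
  have hApp : inner ℝ (A p) p = ∑ j, γ j * inner ℝ (φ j) x ^ 2 := by
    rw [hAp, sum_inner]
    exact Finset.sum_congr rfl fun j _ => by
      rw [inner_smul_left, hφp, conj_trivial]; ring
  have h1 : inner ℝ (A p) p ≤ γ l * ‖p‖ ^ 2 := by
    rw [hApp, hpp, Finset.mul_sum]
    refine Finset.sum_le_sum fun j _ => ?_
    by_cases hj : j < l
    · simp [hx j hj]
    · exact mul_le_mul_of_nonneg_right (h.antitone (not_lt.1 hj)) (sq_nonneg _)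
  have h2 := h.inner_apply_self_le_of_orthogonal hc hA hφy l
  have h3 : ‖x‖ ^ 2 = ‖p‖ ^ 2 + ‖y‖ ^ 2 := by
    rw [hxpy, norm_add_sq_real, hpy]; ring
  have h4 : inner ℝ (A x) x = inner ℝ (A p) p + inner ℝ (A y) y := by
    rw [hxpy, map_add, inner_add_left, inner_add_right, inner_add_right, hApy, hAyp]; ring
  rw [h3, h4]; linarith

/-- Lower half of min-max: the span of `φ 0, …, φ l` has one dimension more than the number of
orthogonality conditions. -/
theorem exists_ne_zero_orthogonal (h : HasLeadingEigensystem A γ φ) (ψ : Fin d → H) (l : Fin d) :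
    ∃ x : H, x ≠ 0 ∧ (∀ j < l, inner ℝ (ψ j) x = 0) ∧ γ l * ‖x‖ ^ 2 ≤ inner ℝ (A x) x := by
  -- Kernel vectors are the coefficients sought: components below `l` encode orthogonality to `ψ i`,
  -- those above `l` force `b i = 0`. Component `l` is identically zero, so `L` is not surjective
  -- and hence not injective.
  let L : (Fin d → ℝ) →ₗ[ℝ] (Fin d → ℝ) := LinearMap.pi fun i =>
    if i < l then ∑ j, (inner ℝ (ψ i) (φ j)) • LinearMap.proj j
    else if i = l then 0 else LinearMap.proj i
  have hLlt : ∀ b, ∀ i < l, L b i = ∑ j, inner ℝ (ψ i) (φ j) * b j := by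
    intro b i hi; simp [L, hi]
  have hLl : ∀ b, L b l = 0 := by
    intro b; simp [L]
  have hLgt : ∀ b i, l < i → L b i = b i := by
    intro b i hi; simp [L, hi.not_gt, hi.ne']
  have hninj : ¬ Function.Injective L := by
    rw [LinearMap.injective_iff_surjective]
    intro hs
    obtain ⟨b, hb⟩ := hs (fun _ => 1)
    have := congrFun hb l
    rw [hLl] at this
    exact zero_ne_one this
  rw [← LinearMap.ker_eq_bot] at hninj
  obtain ⟨b, hbL, hb0⟩ := (Submodule.ne_bot_iff _).1 hninj
  rw [LinearMap.mem_ker] at hbL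
  have hbgt : ∀ i, l < i → b i = 0 := fun i hi => by rw [← hLgt b i hi, hbL]; rfl
  set x : H := ∑ j, b j • φ j with hx
  have hφx : ∀ j, inner ℝ (φ j) x = b j := fun j => by
    rw [hx, h.orthonormal.inner_right_fintype]
  have hnx : ‖x‖ ^ 2 = ∑ j, b j ^ 2 := by
    rw [← real_inner_self_eq_norm_sq]
    nth_rewrite 1 [hx]
    rw [sum_inner]
    exact Finset.sum_congr rfl fun j _ => by rw [inner_smul_left, hφx, conj_trivial, sq]
  refine ⟨x, ?_, ?_, ?_⟩
  · intro h0
    refine hb0 (funext fun j => ?_)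
    rw [← hφx, h0, inner_zero_right]; rfl
  · intro i hi
    have := hLlt b i hi
    rw [hbL] at this
    rw [hx, inner_sum]
    simp only [inner_smul_right]
    simpa [mul_comm] using this.symm
  · have hAx : A x = ∑ j, (b j * γ j) • φ j := by
      rw [hx, map_sum]
      exact Finset.sum_congr rfl fun j _ => by rw [map_smul, h.eigen, smul_smul]
    rw [hAx, sum_inner, hnx, Finset.mul_sum]
    refine Finset.sum_le_sum fun j _ => ?_
    rw [inner_smul_left, hφx, conj_trivial]
    by_cases hj : l < j
    · simp [hbgt j hj]
    · have := mul_le_mul_of_nonneg_right (h.antitone (not_lt.1 hj)) (sq_nonneg (b j))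
      nlinarith

/-- Weyl's inequality: test both forms on a vector from the lower half for `A` that is orthogonal to
the first eigenvectors of `B`. -/
theorem eigenvalue_le_add [CompleteSpace H] (h : HasLeadingEigensystem A γ φ)
    (h' : HasLeadingEigensystem B γ' φ') (hc : IsCompactOperator B)
    (hB : (B : H →ₗ[ℝ] H).IsSymmetric) {ε : ℝ}
    (hAB : ∀ x, inner ℝ (A x) x ≤ inner ℝ (B x) x + ε * ‖x‖ ^ 2) (l : Fin d) :
    γ l ≤ γ' l + ε := by
  obtain ⟨x, hx0, hx, hle⟩ := h.exists_ne_zero_orthogonal φ' l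
  have h1 := h'.inner_apply_self_le hc hB hx
  have h2 := hAB x
  have hpos : 0 < ‖x‖ ^ 2 := by positivity
  have : γ l * ‖x‖ ^ 2 ≤ (γ' l + ε) * ‖x‖ ^ 2 := by linarith
  exact le_of_mul_le_mul_right this hpos

theorem eigenvalue_le_add_norm_sub [CompleteSpace H] (h : HasLeadingEigensystem A γ φ)
    (h' : HasLeadingEigensystem B γ' φ') (hc : IsCompactOperator B)
    (hB : (B : H →ₗ[ℝ] H).IsSymmetric) (l : Fin d) :
    γ l ≤ γ' l + ‖A - B‖ := by
  refine h.eigenvalue_le_add h' hc hB (fun x => ?_) l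
  have h1 : inner ℝ ((A - B) x) x ≤ ‖A - B‖ * ‖x‖ ^ 2 := by
    calc inner ℝ ((A - B) x) x ≤ ‖(A - B) x‖ * ‖x‖ := real_inner_le_norm _ _
      _ ≤ (‖A - B‖ * ‖x‖) * ‖x‖ := by gcongr; exact (A - B).le_opNorm x
      _ = _ := by ring
  rw [sub_apply, inner_sub_left] at h1
  linarith

theorem tendsto_eigenvalue [CompleteSpace H] {An : ℕ → H →L[ℝ] H} {γn : ℕ → Fin d → ℝ}
    {φn : ℕ → Fin d → H} (h : HasLeadingEigensystem A γ φ) (hc : IsCompactOperator A)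
    (hA : (A : H →ₗ[ℝ] H).IsSymmetric) (hn : ∀ n, HasLeadingEigensystem (An n) (γn n) (φn n))
    (hcn : ∀ n, IsCompactOperator (An n)) (hAn : ∀ n, (An n : H →ₗ[ℝ] H).IsSymmetric)
    (hlim : Tendsto An atTop (𝓝 A)) (l : Fin d) :
    Tendsto (fun n => γn n l) atTop (𝓝 (γ l)) := by
  rw [tendsto_iff_norm_sub_tendsto_zero] at hlim ⊢
  refine squeeze_zero (fun _ => norm_nonneg _) (fun n => ?_) hlim
  rw [Real.norm_eq_abs, abs_le]
  have h1 := (hn n).eigenvalue_le_add_norm_sub h hc hA l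
  have h2 := h.eigenvalue_le_add_norm_sub (hn n) (hcn n) (hAn n) l
  rw [norm_sub_rev] at h2
  constructor <;> linarith

end HasLeadingEigensystem

/-- Since `c ≠ 0`, `xn n` is eventually `(cn n)⁻¹ • An n (xn n)`, which by compactness of `A` has
convergent subsequences. Their limits are unit eigenvectors of `A` for `c`, and `hs` gives all of
them the same value `s`. -/
theorem tendsto_inner_sq_eigenvector {An : ℕ → H →L[ℝ] H} (hc : IsCompactOperator A)
    (hlim : Tendsto An atTop (𝓝 A)) {c : ℝ} {cn : ℕ → ℝ} (hcn : Tendsto cn atTop (𝓝 c))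
    (hc0 : c ≠ 0) {xn : ℕ → H} (hxn : ∀ n, ‖xn n‖ = 1) (heig : ∀ n, An n (xn n) = cn n • xn n)
    {Δ : H} {s : ℝ} (hs : ∀ x, ‖x‖ = 1 → A x = c • x → inner ℝ Δ x ^ 2 = s) :
    Tendsto (fun n => inner ℝ Δ (xn n) ^ 2) atTop (𝓝 s) := by
  obtain ⟨K, hK, hAK⟩ := IsCompactOperator.image_closedBall_subset_compact (f := (A : H →ₗ[ℝ] H)) hc 1
  refine tendsto_of_subseq_tendsto fun ns hns => ?_
  have hmem : ∀ n, A (xn (ns n)) ∈ K := fun n => hAK ⟨xn (ns n), by simp [hxn], rfl⟩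
  obtain ⟨z, -, ψ, hψ, hz⟩ := hK.tendsto_subseq hmem
  refine ⟨ψ, ?_⟩
  have hsub : Tendsto (fun n => ns (ψ n)) atTop atTop := hns.comp hψ.tendsto_atTop
  have hdiff : Tendsto (fun n => (An n - A) (xn n)) atTop (𝓝 0) := by
    rw [tendsto_iff_norm_sub_tendsto_zero] at hlim
    refine squeeze_zero_norm (fun n => ?_) hlim
    simpa [hxn] using (An n - A).le_opNorm (xn n)
  have h1 : Tendsto (fun n => cn (ns (ψ n)) • xn (ns (ψ n))) atTop (𝓝 z) := by
    have := (hdiff.comp hsub).add hz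
    rw [zero_add] at this
    refine this.congr fun n => ?_
    simp [heig]
  have h2 : Tendsto (fun n => xn (ns (ψ n))) atTop (𝓝 (c⁻¹ • z)) := by
    have hinv : Tendsto (fun n => (cn (ns (ψ n)))⁻¹) atTop (𝓝 c⁻¹) := (hcn.comp hsub).inv₀ hc0
    have hne : ∀ᶠ n in atTop, cn (ns (ψ n)) ≠ 0 := (hcn.comp hsub).eventually_ne hc0
    refine (hinv.smul h1).congr' ?_
    filter_upwards [hne] with n hn
    rw [smul_smul, inv_mul_cancel₀ hn, one_smul]
  set x := c⁻¹ • z with hx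
  have hx1 : ‖x‖ = 1 := by
    have := h2.norm
    simp only [hxn] at this
    exact (tendsto_nhds_unique this tendsto_const_nhds)
  have hAx : A x = c • x := by
    have h3 : Tendsto (fun n => A (xn (ns (ψ n)))) atTop (𝓝 (A x)) :=
      (A.continuous.tendsto x).comp h2
    rw [tendsto_nhds_unique h3 hz, hx, smul_smul, mul_inv_cancel₀ hc0, one_smul]
  rw [← hs x hx1 hAx]
  exact ((tendsto_const_nhds (x := Δ)).inner h2).pow 2

/-- Orthonormal vectors lie at distance `√2`, so balls of radius `1/2` around them are disjoint. -/
theorem _root_.Orthonormal.countable_index [TopologicalSpace.SeparableSpace H] {ι : Type*} (z : ι → H)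
    (hz : Orthonormal ℝ z) : Countable ι := by
  refine Pairwise.countable_of_isOpen_disjoint (s := fun i => Metric.ball (z i) (1 / 2)) ?_
    (fun _ => Metric.isOpen_ball) (fun i => ⟨z i, Metric.mem_ball_self (by norm_num)⟩)
  intro i j hij
  refine Metric.ball_disjoint_ball ?_
  have h : ‖z i - z j‖ ^ 2 = 2 := by
    rw [norm_sub_sq_real, hz.1, hz.1, hz.2 hij]; norm_num
  rw [dist_eq_norm]
  nlinarith [norm_nonneg (z i - z j)]

/-- For all but countably many rank one perturbations `C + a Δ ⊗ Δ` of a symmetric operator, the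
squared coefficient of `Δ` along a unit eigenvector depends on the eigenvalue only. -/
theorem countable_setOf_inner_sq_ne [TopologicalSpace.SeparableSpace H] {C : H →L[ℝ] H}
    (hC : (C : H →ₗ[ℝ] H).IsSymmetric) (Δ : H) :
    {a : ℝ | ∃ (μ : ℝ) (x y : H), ‖x‖ = 1 ∧ ‖y‖ = 1 ∧
      (C + a • InnerProductSpace.rankOne ℝ Δ Δ) x = μ • x ∧
      (C + a • InnerProductSpace.rankOne ℝ Δ Δ) y = μ • y ∧
      inner ℝ Δ x ^ 2 ≠ inner ℝ Δ y ^ 2}.Countable := by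
  set S := {a : ℝ | ∃ (μ : ℝ) (x y : H), ‖x‖ = 1 ∧ ‖y‖ = 1 ∧
      (C + a • InnerProductSpace.rankOne ℝ Δ Δ) x = μ • x ∧
      (C + a • InnerProductSpace.rankOne ℝ Δ Δ) y = μ • y ∧
      inner ℝ Δ x ^ 2 ≠ inner ℝ Δ y ^ 2} with hS
  have key : ∀ a : S, ∃ (μ : ℝ) (z e : H), ‖z‖ = 1 ∧ C z = μ • z ∧ inner ℝ Δ e ≠ 0 ∧
      C e + ((a : ℝ) * inner ℝ Δ e) • Δ = μ • e := by
    rintro ⟨a, μ, x, y, hx, hy, hax, hay, hne⟩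
    simp only [add_apply, smul_apply,
      InnerProductSpace.rankOne_apply, smul_smul] at hax hay
    -- This combination is orthogonal to `Δ`, so the perturbation does not see it and it is an
    -- eigenvector of `C` itself; it is nonzero because the squared coefficients differ.
    set z := inner ℝ Δ y • x - inner ℝ Δ x • y with hz
    have hz0 : z ≠ 0 := by
      intro h0
      rw [hz, sub_eq_zero] at h0
      have := congrArg norm h0
      rw [norm_smul, norm_smul, hx, hy, mul_one, mul_one, Real.norm_eq_abs, Real.norm_eq_abs] at this
      exact hne ((sq_eq_sq_iff_abs_eq_abs _ _).2 this.symm)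
    have hCz : C z = μ • z := by
      have e1 : C x = μ • x - (a * inner ℝ Δ x) • Δ := eq_sub_of_add_eq hax
      have e2 : C y = μ • y - (a * inner ℝ Δ y) • Δ := eq_sub_of_add_eq hay
      rw [hz, map_sub, map_smul, map_smul, e1, e2]
      module
    have hCz' : C (‖z‖⁻¹ • z) = μ • (‖z‖⁻¹ • z) := by
      rw [map_smul, hCz, smul_comm]
    by_cases h : inner ℝ Δ x = 0
    · refine ⟨μ, ‖z‖⁻¹ • z, y, norm_smul_inv_norm hz0, hCz', fun h' => hne ?_, hay⟩
      rw [h, h']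
    · exact ⟨μ, ‖z‖⁻¹ • z, x, norm_smul_inv_norm hz0, hCz', h, hax⟩
  choose μ z e hz hCz he hCe using key
  -- Two exceptional parameters with one eigenvalue `μ` coincide: symmetry of `C` on `e a`, `e b`
  -- gives `(a - b) ⟪Δ, e a⟫ ⟪Δ, e b⟫ = 0`. So distinct parameters yield orthogonal eigenvectors `z`
  -- of `C`.
  have hinj : Function.Injective μ := by
    intro a b hab
    have h1 := hC (e a) (e b)
    simp only [ContinuousLinearMap.coe_coe] at h1
    rw [eq_sub_of_add_eq (hCe a), eq_sub_of_add_eq (hCe b), inner_sub_left, inner_sub_right,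
      inner_smul_left, inner_smul_left, inner_smul_right, inner_smul_right, hab,
      real_inner_comm Δ (e a)] at h1
    simp only [conj_trivial] at h1
    have h2 : ((a : ℝ) - b) * (inner ℝ Δ (e a) * inner ℝ Δ (e b)) = 0 := by linarith
    have h3 := (mul_eq_zero.1 h2).resolve_right (mul_ne_zero (he a) (he b))
    exact Subtype.ext (sub_eq_zero.1 h3)
  have horth : Orthonormal ℝ z := by
    refine ⟨hz, fun a b hab => ?_⟩
    have h1 := hC (z a) (z b)
    simp only [ContinuousLinearMap.coe_coe] at h1
    rw [hCz, hCz, inner_smul_left, inner_smul_right, conj_trivial] at h1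
    have h2 : (μ a - μ b) * inner ℝ (z a) (z b) = 0 := by linarith
    exact (mul_eq_zero.1 h2).resolve_left (sub_ne_zero.2 fun h => hab (hinj h))
  exact horth.countable_index

end Spectral

/-! ### Tensor kernels and integral operators on `L²([0,1])`. -/

theorem L2I.inner_eq_integral (x y : L2I) : inner ℝ x y = ∫ t : unitInterval, x t * y t := by
  rw [L2.inner_def]
  exact integral_congr_ae (Eventually.of_forall fun t => by simp [mul_comm])

theorem tensorKernel_coeFn (x y : L2I) :
    tensorKernel x y =ᵐ[volume] fun p : unitInterval × unitInterval => x p.1 * y p.2 :=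
  MemLp.coeFn_toLp _

theorem ae_comp_fst {p : unitInterval → Prop} (h : ∀ᵐ t, p t) :
    ∀ᵐ q : unitInterval × unitInterval, p q.1 :=
  Measure.quasiMeasurePreserving_fst.ae h

theorem ae_comp_snd {p : unitInterval → Prop} (h : ∀ᵐ t, p t) :
    ∀ᵐ q : unitInterval × unitInterval, p q.2 :=
  Measure.quasiMeasurePreserving_snd.ae h

theorem inner_tensorKernel (x y x' y' : L2I) :
    inner ℝ (tensorKernel x y) (tensorKernel x' y') = inner ℝ x x' * inner ℝ y y' := by
  rw [L2.inner_def, L2I.inner_eq_integral, L2I.inner_eq_integral]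
  rw [← integral_prod_mul (fun t : unitInterval => x t * x' t) (fun t : unitInterval => y t * y' t)]
  refine integral_congr_ae ?_
  filter_upwards [tensorKernel_coeFn x y, tensorKernel_coeFn x' y'] with p h1 h2
  simp only [h1, h2, RCLike.inner_apply, conj_trivial]
  ring

theorem norm_tensorKernel (x y : L2I) : ‖tensorKernel x y‖ = ‖x‖ * ‖y‖ := by
  have h := inner_tensorKernel x y x y
  rw [real_inner_self_eq_norm_sq, real_inner_self_eq_norm_sq, real_inner_self_eq_norm_sq,
    ← mul_pow] at h
  exact (sq_eq_sq₀ (norm_nonneg _) (by positivity)).1 h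

/-- The tensor product `(x, y) ↦ x ⊗ y` as a continuous bilinear map. -/
def tensorCLM : L2I →L[ℝ] L2I →L[ℝ] L2II :=
  LinearMap.mkContinuous₂ (LinearMap.mk₂ ℝ tensorKernel
    (fun x x' y => by
      refine Lp.ext ?_
      filter_upwards [tensorKernel_coeFn (x + x') y, tensorKernel_coeFn x y,
        tensorKernel_coeFn x' y, Lp.coeFn_add (tensorKernel x y) (tensorKernel x' y),
        ae_comp_fst (Lp.coeFn_add x x')] with p h1 h2 h3 h4 h5
      rw [h1, h4, Pi.add_apply, h2, h3, h5, Pi.add_apply]; ring)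
    (fun c x y => by
      refine Lp.ext ?_
      filter_upwards [tensorKernel_coeFn (c • x) y, tensorKernel_coeFn x y,
        Lp.coeFn_smul c (tensorKernel x y),
        ae_comp_fst (Lp.coeFn_smul c x)] with p h1 h2 h4 h5
      rw [h1, h4, Pi.smul_apply, h2, h5, Pi.smul_apply, smul_eq_mul, smul_eq_mul]; ring)
    (fun x y y' => by
      refine Lp.ext ?_
      filter_upwards [tensorKernel_coeFn x (y + y'), tensorKernel_coeFn x y,
        tensorKernel_coeFn x y', Lp.coeFn_add (tensorKernel x y) (tensorKernel x y'),
        ae_comp_snd (Lp.coeFn_add y y')] with p h1 h2 h3 h4 h5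
      rw [h1, h4, Pi.add_apply, h2, h3, h5, Pi.add_apply]; ring)
    (fun c x y => by
      refine Lp.ext ?_
      filter_upwards [tensorKernel_coeFn x (c • y), tensorKernel_coeFn x y,
        Lp.coeFn_smul c (tensorKernel x y),
        ae_comp_snd (Lp.coeFn_smul c y)] with p h1 h2 h4 h5
      rw [h1, h4, Pi.smul_apply, h2, h5, Pi.smul_apply, smul_eq_mul, smul_eq_mul]; ring)) 1
    (fun x y => by rw [one_mul]; exact (norm_tensorKernel x y).le)

@[simp] theorem tensorCLM_apply (x y : L2I) : tensorCLM x y = tensorKernel x y := rfl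

theorem continuous_tensorKernel_self : Continuous fun x : L2I => tensorKernel x x := by
  simp only [← tensorCLM_apply]
  fun_prop

/-- The integral operator `φ ↦ ∫ K(·, s) φ(s) ds` of a kernel `K`, linear in `K`. -/
def kernelOp : L2II →L[ℝ] L2I →L[ℝ] L2I :=
  LinearMap.mkContinuous₂ (LinearMap.mk₂ ℝ
    (fun K φ => ContinuousLinearMap.adjoint (tensorCLM.flip φ) K)
    (fun K K' φ => by simp) (fun c K φ => by simp)
    (fun K φ φ' => by simp) (fun c K φ => by
      simp)) 1
    (fun K φ => by
      rw [one_mul, mul_comm]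
      refine ((ContinuousLinearMap.adjoint (tensorCLM.flip φ)).le_opNorm K).trans ?_
      gcongr
      rw [LinearIsometryEquiv.norm_map]
      refine ContinuousLinearMap.opNorm_le_bound _ (norm_nonneg _) fun x => ?_
      rw [ContinuousLinearMap.flip_apply, tensorCLM_apply, norm_tensorKernel, mul_comm])

/-- The duality that defines the operator; bounds and algebra come from it without touching
integrals. -/
theorem inner_kernelOp (K : L2II) (φ ψ : L2I) :
    inner ℝ (kernelOp K φ) ψ = inner ℝ K (tensorKernel ψ φ) :=
  ContinuousLinearMap.adjoint_inner_left (tensorCLM.flip φ) ψ K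

theorem kernelOp_tensorKernel (x y : L2I) :
    kernelOp (tensorKernel x y) = rankOne ℝ x y := by
  ext1 φ
  refine ext_inner_right ℝ fun ψ => ?_
  rw [inner_kernelOp, inner_tensorKernel, inner_left_rankOne_apply, real_inner_comm φ y, mul_comm]

theorem integrable_kernel_mul_tensor (K : L2II) (φ ψ : L2I) :
    Integrable fun p : unitInterval × unitInterval => K p * (ψ p.1 * φ p.2) :=
  (Lp.memLp K).integrable_mul (memLp_tensor ψ φ)

theorem integrable_kernel_mul (K : L2II) (φ : L2I) :
    Integrable fun p : unitInterval × unitInterval => K p * φ p.2 := by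
  refine (Lp.memLp K).integrable_mul (q := 2) ?_
  exact MemLp.comp_measurePreserving (Lp.memLp φ) measurePreserving_snd

theorem inner_kernelOp_eq_integral (K : L2II) (φ ψ : L2I) :
    inner ℝ (kernelOp K φ) ψ
      = ∫ t : unitInterval, (∫ s : unitInterval, K (t, s) * φ s) * ψ t := by
  rw [inner_kernelOp, L2.inner_def]
  have h : ∫ p : unitInterval × unitInterval, inner ℝ (K p) (tensorKernel ψ φ p)
      = ∫ p : unitInterval × unitInterval, K p * (ψ p.1 * φ p.2) := by
    refine integral_congr_ae ?_
    filter_upwards [tensorKernel_coeFn ψ φ] with p hp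
    simp only [hp, RCLike.inner_apply, conj_trivial]; ring
  refine (h.trans (integral_prod _ (integrable_kernel_mul_tensor K φ ψ))).trans ?_
  refine integral_congr_ae (Eventually.of_forall fun t => ?_)
  simp only
  rw [← integral_mul_const]
  refine integral_congr_ae (Eventually.of_forall fun s => ?_)
  simp only; ring

/-- Testing the duality against indicators identifies the operator defined by adjoints with the
pointwise integral, almost everywhere. -/
theorem kernelOp_coeFn (K : L2II) (φ : L2I) :
    (fun t : unitInterval => ∫ s : unitInterval, K (t, s) * φ s) =ᵐ[volume] kernelOp K φ := by
  refine Integrable.ae_eq_of_forall_setIntegral_eq _ _ (integrable_kernel_mul K φ).integral_prod_left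
    ((Lp.memLp (kernelOp K φ)).integrable (by norm_num)) fun s hs _ => ?_
  have h1 := inner_kernelOp_eq_integral K φ (indicatorConstLp 2 hs (measure_ne_top _ s) 1)
  rw [L2I.inner_eq_integral] at h1
  have h2 : ∀ f : unitInterval → ℝ, ∫ t, f t * indicatorConstLp 2 hs (measure_ne_top volume s) (1:ℝ) t
      = ∫ t in s, f t := by
    intro f
    rw [← integral_indicator hs]
    refine integral_congr_ae ?_
    filter_upwards [indicatorConstLp_coeFn (p := 2) (hs := hs) (hμs := measure_ne_top volume s) (c := (1 : ℝ))]
      with t ht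
    rw [ht]
    by_cases h : t ∈ s <;> simp [h]
  rw [h2, h2] at h1
  exact h1.symm

theorem ae_integral_eq_iff (K : L2II) (φ : L2I) (c : ℝ) :
    (∀ᵐ t : unitInterval, ∫ s : unitInterval, K (t, s) * φ s = c * φ t) ↔
      kernelOp K φ = c • φ := by
  rw [Lp.ext_iff]
  constructor
  · intro h
    filter_upwards [h, kernelOp_coeFn K φ, Lp.coeFn_smul c φ] with t h1 h2 h3
    rw [← h2, h1, h3]; rfl
  · intro h
    filter_upwards [h, kernelOp_coeFn K φ, Lp.coeFn_smul c φ] with t h1 h2 h3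
    rw [h2, h1, h3]; rfl

theorem IsLeadingEigensystem.hasLeadingEigensystem {d : ℕ} {K : L2II} {γ : Fin d → ℝ}
    {φ : Fin d → L2I} (h : IsLeadingEigensystem K γ φ) :
    HasLeadingEigensystem (kernelOp K) γ φ where
  orthonormal := h.orthonormal
  eigen l := (ae_integral_eq_iff K _ _).1 (h.eigen l)
  antitone := h.antitone
  largest ψ c hψ horth heig := h.largest ψ c hψ
    (fun l => by rw [← L2I.inner_eq_integral]; exact horth l) ((ae_integral_eq_iff K _ _).2 heig)

/-! ### The scalar weights of the limit kernel and of the drift. -/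

section Weights

variable {θ u : ℝ}

theorem changeWeight_of_le (h : u ≤ θ) : changeWeight θ u = (θ - u) / (θ * (1 - u)) := by
  rw [changeWeight, max_eq_right h, min_eq_left h]

theorem changeWeight_of_ge (h : θ ≤ u) : changeWeight θ u = (u - θ) / (u * (1 - θ)) := by
  rw [changeWeight, max_eq_left h, min_eq_right h]

theorem changeWeight_nonneg (hθ : θ ∈ Set.Ioo (0 : ℝ) 1) (hu : u ∈ Set.Ioc (0 : ℝ) 1) :
    0 ≤ changeWeight θ u := by
  have h1 : min u θ ≤ max u θ := min_le_max
  have h2 : min u θ < 1 := min_lt_of_right_lt hθ.2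
  have h3 : 0 < max u θ := lt_max_of_lt_left hu.1
  exact div_nonneg (by linarith) (mul_nonneg h3.le (by linarith))

theorem continuousAt_changeWeight (hθ : θ ∈ Set.Ioo (0 : ℝ) 1) (hu : 0 < u) :
    ContinuousAt (changeWeight θ) u := by
  have h2 : min u θ < 1 := min_lt_of_right_lt hθ.2
  have h3 : 0 < max u θ := lt_max_of_lt_left hu
  unfold changeWeight
  refine ContinuousAt.div (by fun_prop) (by fun_prop) ?_
  exact mul_ne_zero h3.ne' (by linarith)

/-- Injectivity on each side of `θ` turns countably many exceptional perturbation sizes into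
countably many exceptional `u`. -/
theorem injOn_changeWeight_left (hθ : θ ∈ Set.Ioo (0 : ℝ) 1) :
    Set.InjOn (fun u => θ * (1 - θ) * changeWeight θ u) (Set.Ioc 0 θ) := by
  intro u hu v hv h
  have h0 := hθ.1
  have h1 := hθ.2
  simp only [changeWeight_of_le hu.2, changeWeight_of_le hv.2] at h
  have hu1 : 1 - u ≠ 0 := by linarith [hu.2]
  have hv1 : 1 - v ≠ 0 := by linarith [hv.2]
  have h2 : 1 - θ ≠ 0 := by linarith
  field_simp at h
  have : (u - v) * (1 - θ) = 0 := by linarith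
  have := (mul_eq_zero.1 this).resolve_right h2
  linarith

theorem injOn_changeWeight_right (hθ : θ ∈ Set.Ioo (0 : ℝ) 1) :
    Set.InjOn (fun u => θ * (1 - θ) * changeWeight θ u) (Set.Icc θ 1) := by
  intro u hu v hv h
  have h0 := hθ.1
  have h1 := hθ.2
  simp only [changeWeight_of_ge hu.1, changeWeight_of_ge hv.1] at h
  have hu1 : u ≠ 0 := by linarith [hu.1]
  have hv1 : v ≠ 0 := by linarith [hv.1]
  have h2 : 1 - θ ≠ 0 := by linarith
  field_simp at h
  have : (u - v) * θ = 0 := by linarith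
  have := (mul_eq_zero.1 this).resolve_right h0.ne'
  linarith

/-- The function `min(θ, u) (1 - max(θ, u))`. -/
def driftWeight (θ u : ℝ) : ℝ := min θ u * (1 - max θ u)

theorem driftWeight_eq (θ u : ℝ) : driftWeight θ u = min θ u - θ * u := by
  rcases le_total θ u with h | h
  · rw [driftWeight, min_eq_left h, max_eq_right h]; ring
  · rw [driftWeight, min_eq_right h, max_eq_left h]; ring

theorem continuous_driftWeight (θ : ℝ) : Continuous (driftWeight θ) := by
  unfold driftWeight; fun_prop

theorem driftWeight_nonneg (hθ : θ ∈ Set.Icc (0 : ℝ) 1) (hu : u ∈ Set.Icc (0 : ℝ) 1) :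
    0 ≤ driftWeight θ u :=
  mul_nonneg (le_min hθ.1 hu.1) (by linarith [max_le hθ.2 hu.2])

/-- This is what absorbs the singular factor `(u (1 - u))⁻¹` in the estimator. -/
theorem driftWeight_le (hθ : θ ∈ Set.Icc (0 : ℝ) 1) (hu : u ∈ Set.Icc (0 : ℝ) 1) :
    driftWeight θ u ≤ u * (1 - u) := by
  have h1 : max θ u ≤ 1 := max_le hθ.2 hu.2
  exact mul_le_mul (min_le_right _ _) (by linarith [le_max_right θ u]) (by linarith) hu.1

theorem driftWeight_le_one (hθ : θ ∈ Set.Icc (0 : ℝ) 1) (hu : u ∈ Set.Icc (0 : ℝ) 1) :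
    driftWeight θ u ≤ 1 :=
  (driftWeight_le hθ hu).trans (by nlinarith [hu.1, hu.2])

end Weights

/-! ### Averages over `k / N` as integrals of step functions. -/

section Riemann

/-- The ceiling is constant, equal to `k + 1`, on `(k/N, (k+1)/N]`, so the index runs over `1, …, N`
as in the statistic. -/
theorem integral_comp_ceil {N : ℕ} (hN : 0 < N) (f : ℕ → ℝ) :
    ∫ u in (0 : ℝ)..1, f ⌈(N : ℝ) * u⌉₊ = 1 / (N : ℝ) * ∑ k ∈ Finset.Icc 1 N, f k := by
  have hN' : (0 : ℝ) < N := by exact_mod_cast hN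
  have hceil : ∀ k : ℕ, ∀ u ∈ Set.Ioc ((k : ℝ) / N) (((k + 1 : ℕ) : ℝ) / N),
      ⌈(N : ℝ) * u⌉₊ = k + 1 := by
    intro k u hu
    rw [Nat.ceil_eq_iff (by omega)]
    constructor
    · have := hu.1; rw [div_lt_iff₀ hN'] at this
      simp; linarith
    · have := hu.2; rw [le_div_iff₀ hN'] at this
      linarith
  have hle : ∀ k : ℕ, (k : ℝ) / N ≤ ((k + 1 : ℕ) : ℝ) / N := by
    intro k; gcongr; simp
  have hcongr : ∀ k : ℕ, Set.EqOn (fun u => f ⌈(N : ℝ) * u⌉₊) (fun _ => f (k + 1))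
      (Set.Ioc ((k : ℝ) / N) (((k + 1 : ℕ) : ℝ) / N)) := by
    intro k u hu
    simp only [hceil k u hu]
  have hsum := intervalIntegral.sum_integral_adjacent_intervals (μ := volume)
    (f := fun u : ℝ => f ⌈(N : ℝ) * u⌉₊) (a := fun k : ℕ => (k : ℝ) / N) (n := N) (by
      intro k _
      rw [intervalIntegrable_iff_integrableOn_Ioc_of_le (hle k)]
      exact (integrableOn_const (by simp)).congr_fun (hcongr k).symm measurableSet_Ioc)
  have h0 : ((0 : ℕ) : ℝ) / N = 0 := by simp
  have h1 : ((N : ℕ) : ℝ) / N = 1 := div_self hN'.ne'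
  rw [h0, h1] at hsum
  rw [← hsum, Finset.mul_sum, Finset.range_eq_Ico, Finset.sum_Ico_eq_sum_range]
  have hI : Finset.Icc 1 N = Finset.Ico 1 (N + 1) := rfl
  rw [hI, Finset.sum_Ico_eq_sum_range]
  refine Finset.sum_congr (by simp) fun k _ => ?_
  rw [zero_add, intervalIntegral.integral_of_le (hle k),
    setIntegral_congr_fun measurableSet_Ioc (hcongr k), ← intervalIntegral.integral_of_le (hle k),
    intervalIntegral.integral_const, smul_eq_mul, add_comm 1 k]
  push_cast
  ring

theorem ceil_mul_mem_Icc {N : ℕ} (hN : 0 < N) {u : ℝ} (hu : u ∈ Set.Ioc (0 : ℝ) 1) :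
    ⌈(N : ℝ) * u⌉₊ ∈ Finset.Icc 1 N := by
  have hN' : (0 : ℝ) < N := by exact_mod_cast hN
  rw [Finset.mem_Icc]
  refine ⟨Nat.one_le_ceil_iff.2 (mul_pos hN' hu.1), Nat.ceil_le.2 ?_⟩
  nlinarith [hu.2]

theorem div_mem_Ioc {N k : ℕ} (hk : k ∈ Finset.Icc 1 N) : (k : ℝ) / N ∈ Set.Ioc (0 : ℝ) 1 := by
  rw [Finset.mem_Icc] at hk
  have h1 : (0 : ℝ) < k := by exact_mod_cast hk.1
  have h2 : (k : ℝ) ≤ N := by exact_mod_cast hk.2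
  have h3 : (0 : ℝ) < N := h1.trans_le h2
  exact ⟨div_pos h1 h3, (div_le_one h3).2 h2⟩

theorem tendsto_ceil_div {N : ℕ → ℕ} (hN : Tendsto N atTop atTop) {u : ℝ} (hu : 0 ≤ u) :
    Tendsto (fun n => (⌈(N n : ℝ) * u⌉₊ : ℝ) / N n) atTop (𝓝 u) := by
  have h := (tendsto_nat_ceil_mul_div_atTop hu).comp
    ((tendsto_natCast_atTop_atTop (R := ℝ)).comp hN)
  refine h.congr fun n => ?_
  simp [mul_comm]

end Riemann

/-! ### Deterministic convergence of the Riemann sums. -/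

section Limit

variable {H : Type*} [NormedAddCommGroup H] [InnerProductSpace ℝ H]

/-- The operator `C + θ (1 - θ) f_θ(u) Δ ⊗ Δ`. -/
def limitOp (C : H →L[ℝ] H) (θ : ℝ) (Δ : H) (u : ℝ) : H →L[ℝ] H :=
  C + (θ * (1 - θ) * changeWeight θ u) • rankOne ℝ Δ Δ

theorem isCompactOperator_rankOne (x y : H) : IsCompactOperator (rankOne ℝ x y) := by
  have h : IsCompactOperator (innerSL ℝ y) := isCompactOperator_of_locallyCompactSpace_dom _
  exact h.clm_comp (ContinuousLinearMap.toSpanSingleton ℝ x)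

variable {C : H →L[ℝ] H} {θ : ℝ} {Δ : H} {d : ℕ}

theorem isCompactOperator_limitOp (hC : IsCompactOperator C) (u : ℝ) :
    IsCompactOperator (limitOp C θ Δ u) :=
  hC.add ((isCompactOperator_rankOne Δ Δ).smul _)

theorem isSymmetric_limitOp (hC : (C : H →ₗ[ℝ] H).IsSymmetric) (u : ℝ) :
    (limitOp C θ Δ u : H →ₗ[ℝ] H).IsSymmetric := by
  intro x y
  have := hC x y
  simp only [ContinuousLinearMap.coe_coe] at this
  simp [limitOp, inner_add_left, inner_add_right, inner_smul_left, inner_smul_right, this]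
  ring_nf
  simp [real_inner_comm]
  exact Or.inl (mul_comm _ _)

theorem tendsto_limitOp (hθ : θ ∈ Set.Ioo (0 : ℝ) 1) {u : ℝ} (hu : 0 < u) {q : ℕ → ℝ}
    (hq : Tendsto q atTop (𝓝 u)) :
    Tendsto (fun n => limitOp C θ Δ (q n)) atTop (𝓝 (limitOp C θ Δ u)) := by
  have h := (continuousAt_changeWeight hθ hu).tendsto.comp hq
  exact tendsto_const_nhds.add ((tendsto_const_nhds.mul h).smul tendsto_const_nhds)

/-- The squared coefficient of `Δ` along a unit eigenvector of `A` depends on the eigenvalue only. -/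
def HasUniqueInnerSq (A : H →L[ℝ] H) (Δ : H) : Prop :=
  ∀ (μ : ℝ) (x y : H), ‖x‖ = 1 → ‖y‖ = 1 → A x = μ • x → A y = μ • y →
    inner ℝ Δ x ^ 2 = inner ℝ Δ y ^ 2

/-- The size of the rank one perturbation is injective in `u` on each side of `θ`, so the countable
exceptional set pulls back to a null set. -/
theorem ae_hasUniqueInnerSq_limitOp [TopologicalSpace.SeparableSpace H]
    (hC : (C : H →ₗ[ℝ] H).IsSymmetric) (hθ : θ ∈ Set.Ioo (0 : ℝ) 1) (Δ : H) :
    ∀ᵐ u ∂(volume : Measure ℝ), u ∈ Set.Ioc (0 : ℝ) 1 → HasUniqueInnerSq (limitOp C θ Δ u) Δ := by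
  have hcount := countable_setOf_inner_sq_ne hC Δ
  set S := {a : ℝ | ∃ (μ : ℝ) (x y : H), ‖x‖ = 1 ∧ ‖y‖ = 1 ∧
      (C + a • InnerProductSpace.rankOne ℝ Δ Δ) x = μ • x ∧
      (C + a • InnerProductSpace.rankOne ℝ Δ Δ) y = μ • y ∧
      inner ℝ Δ x ^ 2 ≠ inner ℝ Δ y ^ 2} with hS
  set f : ℝ → ℝ := fun u => θ * (1 - θ) * changeWeight θ u with hf
  have h1 : (Set.Ioc 0 θ ∩ f ⁻¹' S).Countable :=
    Set.MapsTo.countable_of_injOn (f := f) (t := S) (fun u hu => hu.2)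
      ((injOn_changeWeight_left hθ).mono Set.inter_subset_left) hcount
  have h2 : (Set.Icc θ 1 ∩ f ⁻¹' S).Countable :=
    Set.MapsTo.countable_of_injOn (f := f) (t := S) (fun u hu => hu.2)
      ((injOn_changeWeight_right hθ).mono Set.inter_subset_left) hcount
  filter_upwards [(h1.union h2).ae_notMem volume] with u hu hu01 μ x y hx hy hax hay
  by_contra hne
  have hmem : u ∈ f ⁻¹' S := ⟨μ, x, y, hx, hy, hax, hay, hne⟩
  rcases le_total u θ with h | h
  · exact hu (Or.inl ⟨⟨hu01.1, h⟩, hmem⟩)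
  · exact hu (Or.inr ⟨⟨h, hu01.2⟩, hmem⟩)

variable [CompleteSpace H] {lam : Fin d → ℝ} {v : Fin d → H} {γ : ℝ → Fin d → ℝ}
  {w : ℝ → Fin d → H}

/-- The perturbation is a nonnegative multiple of `Δ ⊗ Δ`, so it can only raise eigenvalues. This
keeps all denominators away from zero. -/
theorem eigenvalue_le_eigenvalue_limitOp (hC : IsCompactOperator C)
    (hCs : (C : H →ₗ[ℝ] H).IsSymmetric) (hθ : θ ∈ Set.Ioo (0 : ℝ) 1)
    (hlam : HasLeadingEigensystem C lam v) {u : ℝ} (hu : u ∈ Set.Ioc (0 : ℝ) 1)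
    {g : Fin d → ℝ} {φ : Fin d → H} (hw : HasLeadingEigensystem (limitOp C θ Δ u) g φ) (l : Fin d) :
    lam l ≤ g l := by
  have := hlam.eigenvalue_le_add hw (isCompactOperator_limitOp hC u) (isSymmetric_limitOp hCs u)
    (ε := 0) (fun x => ?_) l
  · linarith
  · have h1 : 0 ≤ θ * (1 - θ) * changeWeight θ u :=
      mul_nonneg (mul_nonneg hθ.1.le (by linarith [hθ.2])) (changeWeight_nonneg hθ hu)
    simp only [limitOp, add_apply, smul_apply, rankOne_apply, inner_add_left, inner_smul_left,
      conj_trivial]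
    have := mul_nonneg h1 (mul_self_nonneg (inner ℝ Δ x))
    linarith

theorem tendsto_inner_sq_div_eigenvalue (hC : IsCompactOperator C)
    (hCs : (C : H →ₗ[ℝ] H).IsSymmetric) (hθ : θ ∈ Set.Ioo (0 : ℝ) 1)
    {u : ℝ} (hu : u ∈ Set.Ioc (0 : ℝ) 1) (hgood : HasUniqueInnerSq (limitOp C θ Δ u) Δ)
    {g : Fin d → ℝ} {φ : Fin d → H} (hw : HasLeadingEigensystem (limitOp C θ Δ u) g φ)
    {l : Fin d} (hg : 0 < g l) {q : ℕ → ℝ} (hq : Tendsto q atTop (𝓝 u))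
    {A : ℕ → H →L[ℝ] H} {T : ℕ → H} {gn : ℕ → Fin d → ℝ} {φn : ℕ → Fin d → H}
    (hAc : ∀ n, IsCompactOperator (A n)) (hAs : ∀ n, (A n : H →ₗ[ℝ] H).IsSymmetric)
    (hsys : ∀ n, HasLeadingEigensystem (A n) (gn n) (φn n))
    (hA : Tendsto (fun n => ‖A n - limitOp C θ Δ (q n)‖) atTop (𝓝 0))
    (hT : Tendsto (fun n => ‖T n - driftWeight θ (q n) • Δ‖) atTop (𝓝 0)) :
    Tendsto (fun n => inner ℝ (T n) (φn n l) ^ 2 / gn n l) atTop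
      (𝓝 ((driftWeight θ u * inner ℝ Δ (φ l)) ^ 2 / g l)) := by
  have hAlim : Tendsto A atTop (𝓝 (limitOp C θ Δ u)) := by
    have := (tendsto_zero_iff_norm_tendsto_zero.2 hA).add
      (tendsto_limitOp (C := C) (Δ := Δ) hθ hu.1 hq)
    simpa using this
  have hTlim : Tendsto T atTop (𝓝 (driftWeight θ u • Δ)) := by
    have := (tendsto_zero_iff_norm_tendsto_zero.2 hT).add
      (((continuous_driftWeight θ).tendsto u).comp hq |>.smul_const Δ)
    simpa using this
  have hgn := hw.tendsto_eigenvalue (isCompactOperator_limitOp hC u) (isSymmetric_limitOp hCs u)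
    hsys hAc hAs hAlim l
  have hunit : ∀ n, ‖φn n l‖ = 1 := fun n => (hsys n).orthonormal.1 l
  have hinner := tendsto_inner_sq_eigenvector (isCompactOperator_limitOp hC u) hAlim hgn hg.ne'
    hunit (fun n => (hsys n).eigen l) (Δ := driftWeight θ u • Δ)
    (s := (driftWeight θ u * inner ℝ Δ (φ l)) ^ 2) (fun x hx hAx => by
      rw [inner_smul_left, conj_trivial, mul_pow, mul_pow,
        hgood _ x (φ l) hx (hw.orthonormal.1 l) hAx (hw.eigen l)])
  refine Tendsto.div ?_ hgn hg.ne'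
  have hdiff : Tendsto (fun n => inner ℝ (T n) (φn n l) ^ 2
      - inner ℝ (driftWeight θ u • Δ) (φn n l) ^ 2) atTop (𝓝 0) := by
    have h1 : Tendsto (fun n => ‖T n - driftWeight θ u • Δ‖ * ‖T n + driftWeight θ u • Δ‖)
        atTop (𝓝 0) := by
      have := (tendsto_iff_norm_sub_tendsto_zero.1 hTlim).mul
        (hTlim.add_const (driftWeight θ u • Δ)).norm
      simpa using this
    refine squeeze_zero_norm (fun n => ?_) h1
    have e : inner ℝ (T n) (φn n l) ^ 2 - inner ℝ (driftWeight θ u • Δ) (φn n l) ^ 2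
        = inner ℝ (T n - driftWeight θ u • Δ) (φn n l)
          * inner ℝ (T n + driftWeight θ u • Δ) (φn n l) := by
      rw [inner_sub_left, inner_add_left]; ring
    rw [e, norm_mul]
    have hb : ∀ z : H, ‖inner ℝ z (φn n l)‖ ≤ ‖z‖ := fun z => by
      simpa [hunit n] using norm_inner_le_norm (𝕜 := ℝ) z (φn n l)
    exact mul_le_mul (hb _) (hb _) (norm_nonneg _) (norm_nonneg _)
  simpa using hdiff.add hinner

theorem measurable_comp_ceil (N : ℕ) (f : ℕ → ℝ) :
    Measurable fun u : ℝ => f ⌈(N : ℝ) * u⌉₊ :=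
  (measurable_from_nat (f := f)).comp (Nat.measurable_ceil.comp (measurable_const_mul (N : ℝ)))

section

variable [TopologicalSpace.SeparableSpace H]

theorem ae_tendsto_step (hC : IsCompactOperator C) (hCs : (C : H →ₗ[ℝ] H).IsSymmetric)
    (hθ : θ ∈ Set.Ioo (0 : ℝ) 1) (hlam : HasLeadingEigensystem C lam v) (hpos : ∀ l, 0 < lam l)
    (hw : ∀ u ∈ Set.Ioc (0 : ℝ) 1, HasLeadingEigensystem (limitOp C θ Δ u) (γ u) (w u))
    {N : ℕ → ℕ} (hN : Tendsto N atTop atTop) (hN0 : ∀ n, 0 < N n) {δ : ℕ → ℝ}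
    (hδ : Tendsto δ atTop (𝓝 0)) {A : ℕ → ℕ → H →L[ℝ] H} {T : ℕ → ℕ → H}
    {g : ℕ → ℕ → Fin d → ℝ} {φ : ℕ → ℕ → Fin d → H}
    (hAc : ∀ n, ∀ k ∈ Finset.Icc 1 (N n), IsCompactOperator (A n k))
    (hAs : ∀ n, ∀ k ∈ Finset.Icc 1 (N n), (A n k : H →ₗ[ℝ] H).IsSymmetric)
    (hsys : ∀ n, ∀ k ∈ Finset.Icc 1 (N n), HasLeadingEigensystem (A n k) (g n k) (φ n k))
    (hA : ∀ n, ∀ k ∈ Finset.Icc 1 (N n), ‖A n k - limitOp C θ Δ ((k : ℝ) / N n)‖ ≤ δ n)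
    (hT : ∀ n, ∀ k ∈ Finset.Icc 1 (N n), ‖T n k - driftWeight θ ((k : ℝ) / N n) • Δ‖ ≤ δ n)
    (l : Fin d) :
    ∀ᵐ u ∂(volume : Measure ℝ), u ∈ Set.Ioc (0 : ℝ) 1 →
      Tendsto (fun n => inner ℝ (T n ⌈(N n : ℝ) * u⌉₊) (φ n ⌈(N n : ℝ) * u⌉₊ l) ^ 2
        / g n ⌈(N n : ℝ) * u⌉₊ l) atTop
        (𝓝 ((driftWeight θ u * inner ℝ Δ (w u l)) ^ 2 / γ u l)) := by
  filter_upwards [ae_hasUniqueInnerSq_limitOp hCs hθ Δ] with u hgood hu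
  have hk : ∀ n, ⌈(N n : ℝ) * u⌉₊ ∈ Finset.Icc 1 (N n) := fun n => ceil_mul_mem_Icc (hN0 n) hu
  have hg : 0 < γ u l :=
    (hpos l).trans_le (eigenvalue_le_eigenvalue_limitOp hC hCs hθ hlam hu (hw u hu) l)
  exact tendsto_inner_sq_div_eigenvalue hC hCs hθ hu (hgood hu) (hw u hu) hg
    (tendsto_ceil_div hN hu.1.le) (A := fun n => A n ⌈(N n : ℝ) * u⌉₊)
    (T := fun n => T n ⌈(N n : ℝ) * u⌉₊) (gn := fun n => g n ⌈(N n : ℝ) * u⌉₊)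
    (φn := fun n => φ n ⌈(N n : ℝ) * u⌉₊)
    (fun n => hAc n _ (hk n)) (fun n => hAs n _ (hk n)) (fun n => hsys n _ (hk n))
    (squeeze_zero (fun _ => norm_nonneg _) (fun n => hA n _ (hk n)) hδ)
    (squeeze_zero (fun _ => norm_nonneg _) (fun n => hT n _ (hk n)) hδ)

/-- No measurability of `u ↦ w u` is assumed. The convergence result applied to the limit operators
themselves, sampled on a grid, exhibits the integrand as an a.e. limit of step functions. -/
theorem aestronglyMeasurable_limit (hC : IsCompactOperator C)
    (hCs : (C : H →ₗ[ℝ] H).IsSymmetric)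
    (hθ : θ ∈ Set.Ioo (0 : ℝ) 1) (hlam : HasLeadingEigensystem C lam v) (hpos : ∀ l, 0 < lam l)
    (hw : ∀ u ∈ Set.Ioc (0 : ℝ) 1, HasLeadingEigensystem (limitOp C θ Δ u) (γ u) (w u))
    (l : Fin d) :
    AEStronglyMeasurable (fun u => (driftWeight θ u * inner ℝ Δ (w u l)) ^ 2 / γ u l)
      (volume.restrict (Set.Ioc (0 : ℝ) 1)) := by
  have h := ae_tendsto_step hC hCs hθ hlam hpos hw (N := fun n => n + 1) (tendsto_add_atTop_nat 1)
    (fun n => n.succ_pos) (δ := fun _ => 0) tendsto_const_nhds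
    (A := fun n k => limitOp C θ Δ ((k : ℝ) / (n + 1 : ℕ)))
    (T := fun n k => driftWeight θ ((k : ℝ) / (n + 1 : ℕ)) • Δ)
    (g := fun n k => γ ((k : ℝ) / (n + 1 : ℕ))) (φ := fun n k => w ((k : ℝ) / (n + 1 : ℕ)))
    (fun n k _ => isCompactOperator_limitOp hC _) (fun n k _ => isSymmetric_limitOp hCs _)
    (fun n k hk => hw _ (div_mem_Ioc hk)) (fun n k _ => by simp) (fun n k _ => by simp) l
  rw [← ae_restrict_iff' measurableSet_Ioc] at h
  refine aestronglyMeasurable_of_tendsto_ae atTop (fun n => ?_) h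
  exact (measurable_comp_ceil (n + 1) (fun k =>
    inner ℝ (driftWeight θ ((k : ℝ) / (n + 1 : ℕ)) • Δ) (w ((k : ℝ) / (n + 1 : ℕ)) l) ^ 2
      / γ ((k : ℝ) / (n + 1 : ℕ)) l)).aestronglyMeasurable

theorem intervalIntegrable_limit (hC : IsCompactOperator C)
    (hCs : (C : H →ₗ[ℝ] H).IsSymmetric)
    (hθ : θ ∈ Set.Ioo (0 : ℝ) 1) (hlam : HasLeadingEigensystem C lam v) (hpos : ∀ l, 0 < lam l)
    (hw : ∀ u ∈ Set.Ioc (0 : ℝ) 1, HasLeadingEigensystem (limitOp C θ Δ u) (γ u) (w u))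
    (l : Fin d) :
    IntervalIntegrable (fun u => (driftWeight θ u * inner ℝ Δ (w u l)) ^ 2 / γ u l) volume 0 1 := by
  rw [intervalIntegrable_iff_integrableOn_Ioc_of_le zero_le_one]
  refine Integrable.of_bound (aestronglyMeasurable_limit hC hCs hθ hlam hpos hw l)
    (‖Δ‖ ^ 2 / lam l) ?_
  refine (ae_restrict_iff' measurableSet_Ioc).2 (Eventually.of_forall fun u hu => ?_)
  have hle := eigenvalue_le_eigenvalue_limitOp hC hCs hθ hlam hu (hw u hu) l
  have hg : 0 < γ u l := (hpos l).trans_le hle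
  have hu' : u ∈ Set.Icc (0 : ℝ) 1 := Set.Ioc_subset_Icc_self hu
  have hθ' : θ ∈ Set.Icc (0 : ℝ) 1 := Set.Ioo_subset_Icc_self hθ
  rw [Real.norm_of_nonneg (by positivity)]
  have h1 : |driftWeight θ u * inner ℝ Δ (w u l)| ≤ ‖Δ‖ := by
    rw [abs_mul, abs_of_nonneg (driftWeight_nonneg hθ' hu')]
    have h2 := abs_real_inner_le_norm Δ (w u l)
    rw [(hw u hu).orthonormal.1 l, mul_one] at h2
    calc _ ≤ 1 * ‖Δ‖ := mul_le_mul (driftWeight_le_one hθ' hu') h2 (abs_nonneg _) zero_le_one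
      _ = _ := one_mul _
  have h3 : (driftWeight θ u * inner ℝ Δ (w u l)) ^ 2 ≤ ‖Δ‖ ^ 2 := by
    rw [← sq_abs]; gcongr
  exact div_le_div₀ (sq_nonneg _) h3 (hpos l) hle

theorem tendsto_average (hC : IsCompactOperator C) (hCs : (C : H →ₗ[ℝ] H).IsSymmetric)
    (hθ : θ ∈ Set.Ioo (0 : ℝ) 1) (hlam : HasLeadingEigensystem C lam v) (hpos : ∀ l, 0 < lam l)
    (hw : ∀ u ∈ Set.Ioc (0 : ℝ) 1, HasLeadingEigensystem (limitOp C θ Δ u) (γ u) (w u))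
    {N : ℕ → ℕ} (hN : Tendsto N atTop atTop) (hN0 : ∀ n, 0 < N n) {δ : ℕ → ℝ}
    (hδ : Tendsto δ atTop (𝓝 0)) {A : ℕ → ℕ → H →L[ℝ] H} {T : ℕ → ℕ → H}
    {g : ℕ → ℕ → Fin d → ℝ} {φ : ℕ → ℕ → Fin d → H}
    (hAc : ∀ n, ∀ k ∈ Finset.Icc 1 (N n), IsCompactOperator (A n k))
    (hAs : ∀ n, ∀ k ∈ Finset.Icc 1 (N n), (A n k : H →ₗ[ℝ] H).IsSymmetric)
    (hsys : ∀ n, ∀ k ∈ Finset.Icc 1 (N n), HasLeadingEigensystem (A n k) (g n k) (φ n k))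
    (hA : ∀ n, ∀ k ∈ Finset.Icc 1 (N n), ‖A n k - limitOp C θ Δ ((k : ℝ) / N n)‖ ≤ δ n)
    (hT : ∀ n, ∀ k ∈ Finset.Icc 1 (N n), ‖T n k - driftWeight θ ((k : ℝ) / N n) • Δ‖ ≤ δ n) :
    Tendsto (fun n => 1 / (N n : ℝ) *
        ∑ l, ∑ k ∈ Finset.Icc 1 (N n), inner ℝ (T n k) (φ n k l) ^ 2 / g n k l) atTop
      (𝓝 (∑ l, ∫ u in (0 : ℝ)..1, (driftWeight θ u * inner ℝ Δ (w u l)) ^ 2 / γ u l)) := by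
  simp_rw [Finset.mul_sum Finset.univ]
  refine tendsto_finsetSum _ fun l _ => ?_
  have hθ' : θ ∈ Set.Icc (0 : ℝ) 1 := Set.Ioo_subset_Icc_self hθ
  have heq : ∀ n, 1 / (N n : ℝ) * ∑ k ∈ Finset.Icc 1 (N n), inner ℝ (T n k) (φ n k l) ^ 2 / g n k l
      = ∫ u in (0 : ℝ)..1, inner ℝ (T n ⌈(N n : ℝ) * u⌉₊) (φ n ⌈(N n : ℝ) * u⌉₊ l) ^ 2
        / g n ⌈(N n : ℝ) * u⌉₊ l := fun n =>
    (integral_comp_ceil (hN0 n) (fun k => inner ℝ (T n k) (φ n k l) ^ 2 / g n k l)).symm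
  simp_rw [heq]
  have hstep := ae_tendsto_step hC hCs hθ hlam hpos hw hN hN0 hδ hAc hAs hsys hA hT l
  -- Once `δ n < min 1 (lam l / 2)`, the contrast has norm at most `‖Δ‖ + 1` and the perturbed
  -- eigenvalue is at least `lam l / 2`.
  refine intervalIntegral.tendsto_integral_filter_of_dominated_convergence
    (fun _ => (‖Δ‖ + 1) ^ 2 / (lam l / 2)) ?_ ?_ intervalIntegrable_const ?_
  · exact Eventually.of_forall fun n => (measurable_comp_ceil (N n) (fun k =>
      inner ℝ (T n k) (φ n k l) ^ 2 / g n k l)).aestronglyMeasurable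
  · have h1 : ∀ᶠ n in atTop, δ n < min 1 (lam l / 2) :=
      hδ.eventually_lt_const (lt_min one_pos (half_pos (hpos l)))
    filter_upwards [h1] with n hn
    refine Eventually.of_forall fun u hu => ?_
    rw [Set.uIoc_of_le zero_le_one] at hu
    have hk := ceil_mul_mem_Icc (hN0 n) hu
    set k := ⌈(N n : ℝ) * u⌉₊
    have hq := div_mem_Ioc hk
    have hle := eigenvalue_le_eigenvalue_limitOp hC hCs hθ hlam hq (hw _ hq) l
    have hle2 := (hw _ hq).eigenvalue_le_add_norm_sub (hsys n k hk) (hAc n k hk) (hAs n k hk) l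
    rw [norm_sub_rev] at hle2
    have hle3 : lam l / 2 ≤ g n k l := by
      have := hA n k hk
      have := hn.trans_le (min_le_right _ _)
      linarith
    have hhalf := half_pos (hpos l)
    have hg : 0 < g n k l := hhalf.trans_le hle3
    rw [Real.norm_of_nonneg (by positivity)]
    have hTn : ‖T n k‖ ≤ ‖Δ‖ + 1 := by
      have h2 := norm_le_norm_add_norm_sub' (T n k) (driftWeight θ ((k : ℝ) / N n) • Δ)
      have h3 : ‖driftWeight θ ((k : ℝ) / N n) • Δ‖ ≤ ‖Δ‖ := by
        have hq' := Set.Ioc_subset_Icc_self hq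
        rw [norm_smul, Real.norm_of_nonneg (driftWeight_nonneg hθ' hq')]
        exact mul_le_of_le_one_left (norm_nonneg _) (driftWeight_le_one hθ' hq')
      have := hT n k hk
      have := hn.trans_le (min_le_left _ _)
      linarith
    have h4 := abs_real_inner_le_norm (T n k) (φ n k l)
    rw [(hsys n k hk).orthonormal.1 l, mul_one] at h4
    have h5 : inner ℝ (T n k) (φ n k l) ^ 2 ≤ (‖Δ‖ + 1) ^ 2 := by
      rw [← sq_abs]; gcongr; exact h4.trans hTn
    exact div_le_div₀ (by positivity) h5 hhalf hle3
  · filter_upwards [hstep] with u hu hmem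
    rw [Set.uIoc_of_le zero_le_one] at hmem
    exact hu hmem

/-- Otherwise, counterexamples with `δ = 1/(n+1)` and `N ≥ n+1` form a sequence that contradicts
`tendsto_average`. Quantifying over all systems `A, T, g, φ` avoids any measurable choice. -/
theorem exists_uniform_average_close (hC : IsCompactOperator C)
    (hCs : (C : H →ₗ[ℝ] H).IsSymmetric)
    (hθ : θ ∈ Set.Ioo (0 : ℝ) 1) (hlam : HasLeadingEigensystem C lam v) (hpos : ∀ l, 0 < lam l)
    (hw : ∀ u ∈ Set.Ioc (0 : ℝ) 1, HasLeadingEigensystem (limitOp C θ Δ u) (γ u) (w u))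
    {ε : ℝ} (hε : 0 < ε) :
    ∃ δ > 0, ∃ N₀ : ℕ, ∀ N ≥ N₀, ∀ (A : ℕ → H →L[ℝ] H) (T : ℕ → H) (g : ℕ → Fin d → ℝ)
      (φ : ℕ → Fin d → H), (∀ k ∈ Finset.Icc 1 N, IsCompactOperator (A k)) →
      (∀ k ∈ Finset.Icc 1 N, (A k : H →ₗ[ℝ] H).IsSymmetric) →
      (∀ k ∈ Finset.Icc 1 N, HasLeadingEigensystem (A k) (g k) (φ k)) →
      (∀ k ∈ Finset.Icc 1 N, ‖A k - limitOp C θ Δ ((k : ℝ) / N)‖ ≤ δ) →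
      (∀ k ∈ Finset.Icc 1 N, ‖T k - driftWeight θ ((k : ℝ) / N) • Δ‖ ≤ δ) →
      |1 / (N : ℝ) * ∑ l, ∑ k ∈ Finset.Icc 1 N, inner ℝ (T k) (φ k l) ^ 2 / g k l
        - ∑ l, ∫ u in (0 : ℝ)..1, (driftWeight θ u * inner ℝ Δ (w u l)) ^ 2 / γ u l| < ε := by
  by_contra! hcon
  choose N hN A T g φ hAc hAs hsys hA hT hge using
    fun n : ℕ => hcon (1 / ((n : ℝ) + 1)) (by positivity) (n + 1)
  have hlim := tendsto_average hC hCs hθ hlam hpos hw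
    (tendsto_atTop_mono (fun n => (Nat.le_succ n).trans (hN n)) tendsto_id)
    (fun n => n.succ_pos.trans_le (hN n)) tendsto_one_div_add_atTop_nhds_zero_nat hAc hAs hsys hA hT
  have h := (Metric.tendsto_atTop.1 hlim) ε hε
  obtain ⟨n, hn⟩ := h
  have := hn n le_rfl
  rw [Real.dist_eq] at this
  exact absurd this (not_lt.2 (hge n))

end

end Limit

/-! ### Algebra of scatter operators and contrasts. -/

section RankOne

variable {H : Type*} [NormedAddCommGroup H] [InnerProductSpace ℝ H]

theorem rankOne_self_add (x y : H) :
    rankOne ℝ (x + y) (x + y) = rankOne ℝ x x + rankOne ℝ x y + rankOne ℝ y x + rankOne ℝ y y := by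
  ext z
  simp only [rankOne_apply, add_apply, inner_add_left]
  module

theorem rankOne_self_smul (c : ℝ) (x : H) :
    rankOne ℝ (c • x) (c • x) = c ^ 2 • rankOne ℝ x x := by
  ext z
  simp only [rankOne_apply, smul_apply, inner_smul_left, conj_trivial]
  module

theorem sum_rankOne_sub_self (s : Finset ℕ) (x : ℕ → H) (m : H)
    (hm : (s.card : ℝ) • m = ∑ i ∈ s, x i) :
    ∑ i ∈ s, rankOne ℝ (x i - m) (x i - m)
      = ∑ i ∈ s, rankOne ℝ (x i) (x i) - (s.card : ℝ) • rankOne ℝ m m := by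
  ext z
  simp only [sum_apply, sub_apply, smul_apply, rankOne_apply, inner_sub_left]
  have h1 : ∑ i ∈ s, (inner ℝ (x i) z - inner ℝ m z) • (x i - m)
      = ∑ i ∈ s, inner ℝ (x i) z • x i - (∑ i ∈ s, inner ℝ (x i) z) • m
        - inner ℝ m z • ∑ i ∈ s, x i + (s.card : ℝ) • (inner ℝ m z • m) := by
    rw [Finset.sum_smul, Finset.smul_sum, ← Finset.sum_sub_distrib, ← Finset.sum_sub_distrib]
    have : (s.card : ℝ) • (inner ℝ m z • m) = ∑ i ∈ s, inner ℝ m z • m := by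
      rw [Finset.sum_const, Nat.cast_smul_eq_nsmul]
    rw [this, ← Finset.sum_add_distrib]
    refine Finset.sum_congr rfl fun i _ => ?_
    module
  rw [h1, ← sum_inner, ← hm, inner_smul_left, conj_trivial]
  module

/-- Within-segment and total scatter differ by the contrast of the partial sums. -/
theorem scatter_decomposition (a b : H) {k m : ℝ} (hk : 0 < k) (hm : 0 < m) :
    k⁻¹ • rankOne ℝ a a + m⁻¹ • rankOne ℝ b b
      = (k + m)⁻¹ • rankOne ℝ (a + b) (a + b)
        + ((k + m) * (k / (k + m) * (1 - k / (k + m)))⁻¹) •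
          rankOne ℝ ((k + m)⁻¹ • (a - (k / (k + m)) • (a + b)))
            ((k + m)⁻¹ • (a - (k / (k + m)) • (a + b))) := by
  have hkm : k + m ≠ 0 := by positivity
  have e : 1 - k / (k + m) = m / (k + m) := by field_simp; ring
  have e2 : a - (k / (k + m)) • (a + b) = (k + m)⁻¹ • (m • a - k • b) := by
    match_scalars <;> field_simp
    ring
  rw [e, e2]
  ext z
  simp only [add_apply, smul_apply, rankOne_apply, inner_add_left, inner_sub_left, inner_smul_left,
    conj_trivial]
  match_scalars <;> field_simp <;> ring

end RankOne

/-- The normalized difference of partial sums `N⁻¹ (∑_{i<k} x_i - (k/N) ∑_{i<N} x_i)`. -/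
def contrast {H : Type*} [AddCommGroup H] [Module ℝ H] (N : ℕ) (x : ℕ → H) (k : ℕ) : H :=
  (N : ℝ)⁻¹ • (∑ i ∈ Finset.range k, x i - ((k : ℝ) / N) • ∑ i ∈ Finset.range N, x i)

theorem kernelOp_segmentScatter (s : Finset ℕ) (x : ℕ → L2I) :
    kernelOp (segmentScatter s x) = ∑ i ∈ s, rankOne ℝ (x i) (x i)
      - (s.card : ℝ)⁻¹ • rankOne ℝ (∑ i ∈ s, x i) (∑ i ∈ s, x i) := by
  rw [segmentScatter, map_sum]
  simp_rw [kernelOp_tensorKernel]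
  rcases s.eq_empty_or_nonempty with rfl | hs
  · simp
  have hc : (s.card : ℝ) ≠ 0 := by exact_mod_cast hs.card_ne_zero
  rw [sum_rankOne_sub_self s x (segmentMean s x) (by rw [segmentMean, smul_inv_smul₀ hc]),
    segmentMean, rankOne_self_smul, smul_smul]
  congr 2
  field_simp

theorem natFloor_mul_div {N k : ℕ} (hN : 0 < N) : ⌊(N : ℝ) * ((k : ℝ) / N)⌋₊ = k := by
  have : (N : ℝ) ≠ 0 := by exact_mod_cast hN.ne'
  rw [mul_div_cancel₀ _ this, Nat.floor_natCast]

/-- The total scatter does not depend on `k`; all dependence on the split sits in one rank one term,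
so uniformity in `k` reduces to the contrast. -/
theorem kernelOp_covEstimator {N k : ℕ} (hk : k ∈ Finset.Icc 1 N) (x : ℕ → L2I) :
    kernelOp (covEstimator N x ((k : ℝ) / N))
      = (N : ℝ)⁻¹ • kernelOp (segmentScatter (Finset.range N) x)
        - ((k : ℝ) / N * (1 - (k : ℝ) / N))⁻¹ • rankOne ℝ (contrast N x k) (contrast N x k) := by
  rw [Finset.mem_Icc] at hk
  have hN : 0 < N := by omega
  have hN' : (N : ℝ) ≠ 0 := by exact_mod_cast hN.ne'
  rw [covEstimator, natFloor_mul_div hN, map_smul, map_add, kernelOp_segmentScatter,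
    kernelOp_segmentScatter, kernelOp_segmentScatter]
  rcases hk.2.eq_or_lt with rfl | hlt
  -- At `k = N` the second segment is empty and the singular coefficient is `0⁻¹ = 0`.
  · simp [div_self hN']
  have hsum := Finset.sum_range_add_sum_Ico (fun i => rankOne ℝ (x i) (x i)) hk.2
  have hsum' := Finset.sum_range_add_sum_Ico x hk.2
  set a := ∑ i ∈ Finset.range k, x i
  set b := ∑ i ∈ Finset.Ico k N, x i
  have hk0 : (0 : ℝ) < k := by exact_mod_cast hk.1
  have hm0 : (0 : ℝ) < ((N - k : ℕ) : ℝ) := by exact_mod_cast Nat.sub_pos_of_lt hlt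
  have hkm : (k : ℝ) + ((N - k : ℕ) : ℝ) = N := by
    rw [Nat.cast_sub hk.2]; ring
  have hdec := scatter_decomposition a b hk0 hm0
  rw [hkm, hsum'] at hdec
  rw [contrast, ← hsum, Finset.card_range, Finset.card_range, Nat.card_Ico]
  set p := ∑ i ∈ Finset.range k, rankOne ℝ (x i) (x i)
  set q := ∑ i ∈ Finset.Ico k N, rankOne ℝ (x i) (x i)
  have : p - (k : ℝ)⁻¹ • rankOne ℝ a a + (q - ((N - k : ℕ) : ℝ)⁻¹ • rankOne ℝ b b)
    = p + q - ((k : ℝ)⁻¹ • rankOne ℝ a a + ((N - k : ℕ) : ℝ)⁻¹ • rankOne ℝ b b) := by abel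
  rw [this, hdec, ← sub_sub, smul_sub _ _ (_ • _), smul_smul, inv_mul_cancel_left₀ hN']

theorem segmentScatter_const_add (s : Finset ℕ) (m : L2I) (z : ℕ → L2I) :
    segmentScatter s (fun i => m + z i) = segmentScatter s z := by
  unfold segmentScatter
  refine Finset.sum_congr rfl fun i hi => ?_
  have hc : (s.card : ℝ) ≠ 0 := by exact_mod_cast Finset.card_ne_zero_of_mem hi
  have : segmentMean s (fun i => m + z i) = m + segmentMean s z := by
    rw [segmentMean, segmentMean, Finset.sum_add_distrib, Finset.sum_const, smul_add,
      ← Nat.cast_smul_eq_nsmul ℝ, inv_smul_smul₀ hc]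
  rw [this, add_sub_add_left_eq_sub]

section Contrast

variable {H : Type*} [NormedAddCommGroup H] [InnerProductSpace ℝ H]

/-- The common mean `m` cancels, and the first `k` observations contain `min K k` shifts by `Δ`. -/
theorem contrast_change {N k K : ℕ} (hk : k ∈ Finset.Icc 1 N) (hK : K ≤ N) (m Δ : H) (y : ℕ → H) :
    contrast N (fun i => m + ((if i < K then Δ else 0) + y i)) k
      = driftWeight ((K : ℝ) / N) ((k : ℝ) / N) • Δ + contrast N y k := by
  rw [Finset.mem_Icc] at hk
  have hN : (0 : ℝ) < N := by exact_mod_cast (show 0 < N by omega)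
  have hsum : ∀ j : ℕ, ∑ i ∈ Finset.range j, (m + ((if i < K then Δ else 0) + y i))
      = (j : ℝ) • m + (min (K : ℝ) j) • Δ + ∑ i ∈ Finset.range j, y i := by
    intro j
    rw [Finset.sum_add_distrib, Finset.sum_add_distrib, Finset.sum_const, Finset.card_range,
      ← Finset.sum_filter, Finset.sum_const]
    have : (Finset.range j).filter (fun i => i < K) = Finset.range (min K j) := by
      ext i; simp; omega
    rw [this, Finset.card_range, ← Nat.cast_smul_eq_nsmul ℝ, ← Nat.cast_smul_eq_nsmul ℝ,
      Nat.cast_min]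
    abel
  have hKN : min (K : ℝ) N = K := min_eq_left (by exact_mod_cast hK)
  have hmin : min ((K : ℝ) / N) ((k : ℝ) / N) = min (K : ℝ) k / N :=
    (min_div_div_right hN.le _ _)
  rw [contrast, contrast, hsum, hsum, driftWeight_eq, hmin, hKN]
  match_scalars <;> field_simp
  ring

end Contrast

/-! ### Bounds on partial sums, uniform in the splitting point. -/

section PartialSums

/-- If `b k = o(k)` then the maximum over `k ≤ N` is `o(N)`: the finitely many small `k` are bounded
by a constant. -/
theorem eventually_forall_le_mul {b : ℕ → ℝ} (hb : Tendsto (fun k : ℕ => b k / k) atTop (𝓝 0))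
    {ε : ℝ} (hε : 0 < ε) : ∀ᶠ N : ℕ in atTop, ∀ k ≤ N, |b k| ≤ ε * N := by
  have h1 : ∀ᶠ k : ℕ in atTop, |b k / k| < ε := by
    have := hb.abs
    rw [abs_zero] at this
    exact this.eventually_lt_const hε
  obtain ⟨K, hK⟩ := eventually_atTop.1 (h1.and (eventually_gt_atTop 0))
  have h2 : ∀ᶠ N : ℕ in atTop, ∑ j ∈ Finset.range K, |b j| ≤ ε * N :=
    (tendsto_natCast_atTop_atTop.const_mul_atTop hε).eventually_ge_atTop _
  filter_upwards [h2] with N hN k hkN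
  rcases lt_or_ge k K with h | h
  · exact (Finset.single_le_sum (f := fun j => |b j|) (fun j _ => abs_nonneg _)
      (Finset.mem_range.2 h)).trans hN
  · obtain ⟨h3, h4⟩ := hK k h
    have hk : (0 : ℝ) < k := by exact_mod_cast h4
    rw [abs_div, abs_of_pos hk, div_lt_iff₀ hk] at h3
    have : (k : ℝ) ≤ N := by exact_mod_cast hkN
    nlinarith

variable {H : Type*} [NormedAddCommGroup H] [InnerProductSpace ℝ H]

theorem norm_sum_sq_le_card_mul {E : Type*} [SeminormedAddCommGroup E] (s : Finset ℕ) (y : ℕ → E) :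
    ‖∑ i ∈ s, y i‖ ^ 2 ≤ s.card * ∑ i ∈ s, ‖y i‖ ^ 2 := by
  refine le_trans ?_ (sq_sum_le_card_mul_sum_sq (s := s) (f := fun i => ‖y i‖))
  gcongr
  exact norm_sum_le _ _

theorem tendsto_norm_sum_div {y : ℕ → H}
    (h : Tendsto (fun n : ℕ => (n : ℝ)⁻¹ • ∑ i ∈ Finset.range n, y i) atTop (𝓝 0)) :
    Tendsto (fun n : ℕ => ‖∑ i ∈ Finset.range n, y i‖ / n) atTop (𝓝 0) := by
  have := h.norm
  rw [norm_zero] at this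
  refine this.congr fun n => ?_
  rw [norm_smul, Real.norm_of_nonneg (by positivity), div_eq_inv_mul]

theorem eventually_norm_head_sq_le {y : ℕ → H}
    (h : Tendsto (fun n : ℕ => (n : ℝ)⁻¹ • ∑ i ∈ Finset.range n, y i) atTop (𝓝 0))
    {ε : ℝ} (hε : 0 < ε) :
    ∀ᶠ N : ℕ in atTop, ∀ k ≤ N, ‖∑ i ∈ Finset.range k, y i‖ ^ 2 ≤ ε * N * k := by
  have h1 := tendsto_norm_sum_div h
  have h2 : Tendsto (fun k : ℕ => (‖∑ i ∈ Finset.range k, y i‖ ^ 2 / k) / k) atTop (𝓝 0) := by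
    have := h1.pow 2
    rw [zero_pow two_ne_zero] at this
    refine this.congr fun n => ?_
    rw [div_pow, div_div, sq (n : ℝ)]
  filter_upwards [eventually_forall_le_mul h2 hε] with N hN k hk
  rcases k.eq_zero_or_pos with rfl | h0
  · simp
  have h3 := hN k hk
  have hk0 : (0 : ℝ) < k := by exact_mod_cast h0
  rw [abs_of_nonneg (by positivity), div_le_iff₀ hk0] at h3
  exact h3

/-- The law of large numbers for `y` alone gives only `o(N²)`, which is too weak when `N - k` is
small. There, Cauchy–Schwarz gives `(N - k) ∑ ‖y i‖²`, and the law for `‖y i‖²` bounds the last sum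
by `ε N`. -/
theorem eventually_norm_tail_sq_le {y : ℕ → H}
    (h : Tendsto (fun n : ℕ => (n : ℝ)⁻¹ • ∑ i ∈ Finset.range n, y i) atTop (𝓝 0)) {σ : ℝ}
    (hσ : Tendsto (fun n : ℕ => (n : ℝ)⁻¹ • ∑ i ∈ Finset.range n, ‖y i‖ ^ 2) atTop (𝓝 σ))
    {ε : ℝ} (hε : 0 < ε) :
    ∀ᶠ N : ℕ in atTop, ∀ k ≤ N, ‖∑ i ∈ Finset.Ico k N, y i‖ ^ 2 ≤ ε * N * ((N : ℝ) - k) := by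
  have hσ0 : 0 ≤ σ := ge_of_tendsto hσ (Eventually.of_forall fun n => by positivity)
  set Q : ℕ → ℝ := fun n => ∑ i ∈ Finset.range n, ‖y i‖ ^ 2 with hQ
  have hQ1 : Tendsto (fun k : ℕ => (Q k - σ * k) / k) atTop (𝓝 0) := by
    have := hσ.sub_const σ
    rw [sub_self] at this
    refine this.congr' ?_
    filter_upwards [eventually_gt_atTop 0] with n hn
    have : (n : ℝ) ≠ 0 := by exact_mod_cast hn.ne'
    rw [smul_eq_mul]
    field_simp
    rfl
  set η := ε / 4 with hη
  have hη0 : 0 < η := by positivity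
  set δ := ε / (2 * (σ + 1)) with hδ
  have hδ0 : 0 < δ := by positivity
  have hδσ : σ * δ ≤ ε / 2 := by
    rw [hδ, mul_div_assoc', div_le_div_iff₀ (by positivity) two_pos]
    nlinarith
  -- Chosen so that `(√τ N)² = ε N · δ N`, which is below the target when `N - k > δ N`.
  set τ := ε * δ with hτ
  have hτ0 : 0 < τ := by positivity
  have hρ := eventually_forall_le_mul (tendsto_norm_sum_div h)
    (ε := Real.sqrt τ / 2) (by positivity)
  filter_upwards [eventually_forall_le_mul hQ1 hη0, hρ] with N hN1 hN2 k hk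
  have hkN : (k : ℝ) ≤ N := by exact_mod_cast hk
  have hN0 : (0 : ℝ) ≤ N := Nat.cast_nonneg _
  rcases le_or_gt ((N : ℝ) - k) (δ * N) with hle | hgt
  · have h1 := norm_sum_sq_le_card_mul (Finset.Ico k N) y
    rw [Nat.card_Ico, Nat.cast_sub hk] at h1
    have h2 : ∑ i ∈ Finset.Ico k N, ‖y i‖ ^ 2 = Q N - Q k := by
      rw [Finset.sum_Ico_eq_sub _ hk]
    have h3 := (abs_le.1 (hN1 N le_rfl)).2
    have h4 := (abs_le.1 (hN1 k hk)).1
    have h5 : σ * ((N : ℝ) - k) ≤ σ * (δ * N) := mul_le_mul_of_nonneg_left hle hσ0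
    have h6 : σ * (δ * N) ≤ ε / 2 * N := by
      rw [← mul_assoc]; exact mul_le_mul_of_nonneg_right hδσ hN0
    have h7 : Q N - Q k ≤ ε * N := by
      have : 2 * (η * N) = ε / 2 * N := by rw [hη]; ring
      linarith
    rw [h2] at h1
    calc _ ≤ _ := h1
      _ ≤ ((N : ℝ) - k) * (ε * N) := mul_le_mul_of_nonneg_left h7 (by linarith)
      _ = _ := by ring
  · have h1 : ‖∑ i ∈ Finset.Ico k N, y i‖ ≤ Real.sqrt τ * N := by
      rw [Finset.sum_Ico_eq_sub _ hk]
      have h2 := hN2 N le_rfl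
      have h3 := hN2 k hk
      rw [abs_norm] at h2 h3
      have := norm_sub_le (∑ i ∈ Finset.range N, y i) (∑ i ∈ Finset.range k, y i)
      linarith
    calc ‖∑ i ∈ Finset.Ico k N, y i‖ ^ 2 ≤ (Real.sqrt τ * N) ^ 2 := by gcongr
      _ = ε * N * (δ * N) := by rw [mul_pow, Real.sq_sqrt hτ0.le, hτ]; ring
      _ ≤ ε * N * ((N : ℝ) - k) := by gcongr

theorem eventually_norm_contrast_sq_le {y : ℕ → H}
    (h : Tendsto (fun n : ℕ => (n : ℝ)⁻¹ • ∑ i ∈ Finset.range n, y i) atTop (𝓝 0)) {σ : ℝ}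
    (hσ : Tendsto (fun n : ℕ => (n : ℝ)⁻¹ • ∑ i ∈ Finset.range n, ‖y i‖ ^ 2) atTop (𝓝 σ))
    {ε : ℝ} (hε : 0 < ε) :
    ∀ᶠ N : ℕ in atTop, ∀ k ∈ Finset.Icc 1 N,
      ‖contrast N y k‖ ^ 2 ≤ ε * ((k : ℝ) / N * (1 - (k : ℝ) / N)) := by
  filter_upwards [eventually_norm_head_sq_le h (half_pos hε),
    eventually_norm_tail_sq_le h hσ (half_pos hε)] with N hN1 hN2 k hk
  have hq := div_mem_Ioc hk
  rw [Finset.mem_Icc] at hk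
  have h1 := hN1 k hk.2
  have h2 := hN2 k hk.2
  have hN : (0 : ℝ) < N := by exact_mod_cast (show 0 < N by omega)
  have hsum := Finset.sum_range_add_sum_Ico y hk.2
  set a := ∑ i ∈ Finset.range k, y i
  set b := ∑ i ∈ Finset.Ico k N, y i
  have hkq : (k : ℝ) = (k : ℝ) / N * N := by field_simp
  set q := (k : ℝ) / N with hqdef
  rw [hkq] at h1 h2
  -- With head `a` and tail `b` the weights are `1 - q` and `q`; the bounds `q` and `1 - q` for the
  -- squares then combine to `q (1 - q)`.
  have hc : contrast N y k = (N : ℝ)⁻¹ • ((1 - q) • a - q • b) := by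
    rw [contrast, ← hsum]
    module
  have h3 : ‖(1 - q) • a - q • b‖ ^ 2 ≤ 2 * ((1 - q) ^ 2 * ‖a‖ ^ 2 + q ^ 2 * ‖b‖ ^ 2) := by
    have h4 : ‖(1 - q) • a - q • b‖ ≤ (1 - q) * ‖a‖ + q * ‖b‖ := by
      refine (norm_sub_le _ _).trans ?_
      rw [norm_smul, norm_smul, Real.norm_of_nonneg (by linarith [hq.2]),
        Real.norm_of_nonneg hq.1.le]
    calc ‖(1 - q) • a - q • b‖ ^ 2 ≤ ((1 - q) * ‖a‖ + q * ‖b‖) ^ 2 := by gcongr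
      _ ≤ _ := by nlinarith [sq_nonneg ((1 - q) * ‖a‖ - q * ‖b‖)]
  rw [hc, norm_smul, mul_pow, norm_inv, Real.norm_of_nonneg hN.le, inv_pow,
    inv_mul_le_iff₀ (by positivity)]
  have h5 : (1 - q) ^ 2 * ‖a‖ ^ 2 ≤ (1 - q) ^ 2 * (ε / 2 * N * (q * N)) := by gcongr
  have h6 : q ^ 2 * ‖b‖ ^ 2 ≤ q ^ 2 * (ε / 2 * N * (N - q * N)) := by gcongr
  have h7 : 2 * ((1 - q) ^ 2 * (ε / 2 * N * (q * N)) + q ^ 2 * (ε / 2 * N * (N - q * N)))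
      = N ^ 2 * (ε * (q * (1 - q))) := by ring
  linarith

end PartialSums

/-! ### Uniform convergence of the covariance estimators and contrasts. -/

section Estimator

variable {θ : ℝ}

/-- Population version of the scatter decomposition: total between-group weight minus the squared
drift over `u (1 - u)`. At `u = 1` the inverse is zero and both sides equal `θ (1 - θ)`. -/
theorem changeWeight_eq_sub {u : ℝ} (hθ : θ ∈ Set.Ioo (0 : ℝ) 1) (hu : u ∈ Set.Ioc (0 : ℝ) 1) :
    θ * (1 - θ) * changeWeight θ u
      = θ * (1 - θ) - (u * (1 - u))⁻¹ * driftWeight θ u ^ 2 := by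
  have h0 := hθ.1.ne'
  have h1 : 1 - θ ≠ 0 := by linarith [hθ.2]
  have hu0 := hu.1.ne'
  rcases le_total θ u with h | h
  · rw [changeWeight_of_ge h, driftWeight, min_eq_left h, max_eq_right h]
    rcases hu.2.eq_or_lt with rfl | hu1
    · simp [h1]
    · have hu1' : 1 - u ≠ 0 := by linarith
      field_simp
      ring
  · have hu1' : 1 - u ≠ 0 := by linarith [hθ.2]
    rw [changeWeight_of_le h, driftWeight, min_eq_right h, max_eq_left h]
    field_simp
    ring

theorem abs_driftWeight_sub_le {θ' u : ℝ} (hu : u ∈ Set.Icc (0 : ℝ) 1) :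
    |driftWeight θ' u - driftWeight θ u| ≤ 2 * |θ' - θ| := by
  rw [driftWeight_eq, driftWeight_eq]
  have h1 : |min θ' u - min θ u| ≤ |θ' - θ| := by
    have := abs_min_sub_min_le_max θ' u θ u
    simpa using this
  have h2 : |(θ' - θ) * u| ≤ |θ' - θ| := by
    rw [abs_mul, abs_of_nonneg hu.1]
    exact mul_le_of_le_one_right (abs_nonneg _) hu.2
  have h3 : min θ' u - θ' * u - (min θ u - θ * u) = (min θ' u - min θ u) - (θ' - θ) * u := by ring
  rw [h3]
  exact (abs_sub _ _).trans (by linarith)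

/-- Expanding the square, every term carries a factor `u (1 - u)`: the first two through the drift
weights, the last through the hypothesis on `R`. -/
theorem norm_rankOne_perturbation_le {H : Type*} [NormedAddCommGroup H] [InnerProductSpace ℝ H]
    {θ' u ε : ℝ} (hθ : θ ∈ Set.Icc (0 : ℝ) 1) (hθ' : θ' ∈ Set.Icc (0 : ℝ) 1)
    (hu : u ∈ Set.Ioc (0 : ℝ) 1) (hε : 0 ≤ ε) (Δ R : H)
    (hR : ‖R‖ ^ 2 ≤ ε ^ 2 * (u * (1 - u))) :
    ‖(u * (1 - u))⁻¹ • (rankOne ℝ (driftWeight θ' u • Δ + R) (driftWeight θ' u • Δ + R)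
        - driftWeight θ u ^ 2 • rankOne ℝ Δ Δ)‖
      ≤ 4 * |θ' - θ| * ‖Δ‖ ^ 2 + 2 * ε * ‖Δ‖ + ε ^ 2 := by
  have hu' := Set.Ioc_subset_Icc_self hu
  rcases hu.2.eq_or_lt with rfl | hu1
  · simp only [sub_self, mul_zero, inv_zero, zero_smul, norm_zero]
    positivity
  set p := u * (1 - u) with hp
  have hp0 : 0 < p := mul_pos hu.1 (by linarith)
  have hp1 : p ≤ 1 := mul_le_one₀ hu.2 (by linarith) (by linarith [hu.1])
  set s := driftWeight θ' u
  set t := driftWeight θ u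
  have hs0 : 0 ≤ s := driftWeight_nonneg hθ' hu'
  have ht0 : 0 ≤ t := driftWeight_nonneg hθ hu'
  have hsp : s ≤ p := driftWeight_le hθ' hu'
  have htp : t ≤ p := driftWeight_le hθ hu'
  have hst : |s - t| ≤ 2 * |θ' - θ| := abs_driftWeight_sub_le hu'
  have hRε : ‖R‖ ≤ ε := by
    refine (sq_le_sq₀ (norm_nonneg _) hε).1 (hR.trans ?_)
    exact mul_le_of_le_one_right (sq_nonneg _) hp1
  have e : rankOne ℝ (s • Δ + R) (s • Δ + R) - t ^ 2 • rankOne ℝ Δ Δ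
      = ((s - t) * (s + t)) • rankOne ℝ Δ Δ + s • (rankOne ℝ Δ R + rankOne ℝ R Δ)
        + rankOne ℝ R R := by
    ext z
    simp only [add_apply, sub_apply, smul_apply, rankOne_apply, inner_add_left, inner_smul_left,
      conj_trivial]
    module
  rw [e, norm_smul, norm_inv, Real.norm_of_nonneg hp0.le, inv_mul_le_iff₀ hp0]
  have h1 : ‖((s - t) * (s + t)) • rankOne ℝ Δ Δ‖ ≤ p * (4 * |θ' - θ| * ‖Δ‖ ^ 2) := by
    rw [norm_smul, norm_rankOne, norm_mul, Real.norm_eq_abs, Real.norm_of_nonneg (by linarith)]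
    calc |s - t| * (s + t) * (‖Δ‖ * ‖Δ‖) ≤ (2 * |θ' - θ|) * (p + p) * (‖Δ‖ * ‖Δ‖) := by gcongr
      _ = _ := by ring
  have h2 : ‖s • (rankOne ℝ Δ R + rankOne ℝ R Δ)‖ ≤ p * (2 * ε * ‖Δ‖) := by
    rw [norm_smul, Real.norm_of_nonneg hs0]
    have : ‖rankOne ℝ Δ R + rankOne ℝ R Δ‖ ≤ 2 * ε * ‖Δ‖ := by
      refine (norm_add_le _ _).trans ?_
      rw [norm_rankOne, norm_rankOne]
      nlinarith [norm_nonneg Δ]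
    exact mul_le_mul hsp this (norm_nonneg _) hp0.le
  have h3 : ‖rankOne ℝ R R‖ ≤ p * ε ^ 2 := by
    rw [norm_rankOne, ← sq, mul_comm]; exact hR
  refine (norm_add₃_le).trans ?_
  linarith

theorem changeSample_eq {Ω : Type*} (θ : ℝ) (μ₁ μ₂ : L2I) (Y : ℕ → Ω → L2I) (N : ℕ) (ω : Ω) :
    changeSample θ μ₁ μ₂ Y N ω
      = fun i => μ₂ + ((if i < ⌊(N : ℝ) * θ⌋₊ then μ₁ - μ₂ else 0) + Y i ω) := by
  funext i
  rw [changeSample]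
  split_ifs <;> abel

/-- Expanding around the change, the cross terms are averages of the noise and vanish. What remains
is `C + θ Δ ⊗ Δ`, minus `θ² Δ ⊗ Δ` from the sample mean. -/
theorem tendsto_totalScatter {y : ℕ → L2I} {C : L2I →L[ℝ] L2I} {K : ℕ → ℕ} (hK : ∀ N, K N ≤ N)
    (hKlim : Tendsto K atTop atTop)
    (hKθ : Tendsto (fun N : ℕ => (K N : ℝ) / N) atTop (𝓝 θ)) (Δ : L2I)
    (h : Tendsto (fun n : ℕ => (n : ℝ)⁻¹ • ∑ i ∈ Finset.range n, y i) atTop (𝓝 0))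
    (hC : Tendsto (fun n : ℕ => (n : ℝ)⁻¹ • ∑ i ∈ Finset.range n, rankOne ℝ (y i) (y i)) atTop
      (𝓝 C)) :
    Tendsto (fun N : ℕ => (N : ℝ)⁻¹ • kernelOp (segmentScatter (Finset.range N)
      (fun i => (if i < K N then Δ else 0) + y i))) atTop
      (𝓝 (C + (θ * (1 - θ)) • rankOne ℝ Δ Δ)) := by
  have hSK : Tendsto (fun N : ℕ => (N : ℝ)⁻¹ • ∑ i ∈ Finset.range (K N), y i) atTop (𝓝 0) := by
    have h1 := hKθ.smul (h.comp hKlim)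
    rw [smul_zero] at h1
    refine h1.congr' ?_
    filter_upwards [hKlim.eventually_gt_atTop 0] with N hN
    have : (K N : ℝ) ≠ 0 := by exact_mod_cast hN.ne'
    simp only [Function.comp]
    rw [smul_smul]
    congr 1
    field_simp
  have hm : Tendsto (fun N : ℕ => ((K N : ℝ) / N) • Δ + (N : ℝ)⁻¹ • ∑ i ∈ Finset.range N, y i)
      atTop (𝓝 (θ • Δ)) := by
    have := (hKθ.smul_const Δ).add h
    rwa [add_zero] at this
  have hrk : Continuous fun x : L2I => rankOne ℝ x x :=
    (rankOne ℝ).continuous.clm_apply continuous_id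
  have hcross1 : Tendsto (fun N : ℕ => rankOne ℝ Δ ((N : ℝ)⁻¹ • ∑ i ∈ Finset.range (K N), y i))
      atTop (𝓝 0) := by
    have h1 := ((rankOne ℝ Δ).continuous.tendsto 0).comp hSK
    rwa [map_zero] at h1
  have hcross2 : Tendsto (fun N : ℕ => rankOne ℝ ((N : ℝ)⁻¹ • ∑ i ∈ Finset.range (K N), y i) Δ)
      atTop (𝓝 0) := by
    have hc : Continuous fun x : L2I => rankOne ℝ x Δ :=
      (rankOne ℝ).continuous.clm_apply continuous_const
    have h0 : rankOne ℝ (0 : L2I) Δ = 0 := by simp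
    have h1 := (hc.tendsto 0).comp hSK
    rwa [h0] at h1
  have hlim := (((hC.add (hcross1.add hcross2)).add (hKθ.smul_const (rankOne ℝ Δ Δ))).sub
    ((hrk.tendsto _).comp hm))
  have hval : C + (0 + 0) + θ • rankOne ℝ Δ Δ - rankOne ℝ (θ • Δ) (θ • Δ)
      = C + (θ * (1 - θ)) • rankOne ℝ Δ Δ := by
    rw [rankOne_self_smul]; module
  rw [hval] at hlim
  refine hlim.congr' ?_
  filter_upwards [eventually_gt_atTop 0] with N hN
  have hN0 : (N : ℝ) ≠ 0 := by exact_mod_cast hN.ne'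
  have hfilter : (Finset.range N).filter (fun i => i < K N) = Finset.range (K N) := by
    have := hK N
    ext i; simp; omega
  have hsum : ∑ i ∈ Finset.range N, ((if i < K N then Δ else 0) + y i)
      = (K N : ℝ) • Δ + ∑ i ∈ Finset.range N, y i := by
    rw [Finset.sum_add_distrib, ← Finset.sum_filter, hfilter, Finset.sum_const, Finset.card_range,
      Nat.cast_smul_eq_nsmul]
  have hsq : ∑ i ∈ Finset.range N, rankOne ℝ ((if i < K N then Δ else 0) + y i)
        ((if i < K N then Δ else 0) + y i)
      = ∑ i ∈ Finset.range N, rankOne ℝ (y i) (y i)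
        + (rankOne ℝ Δ (∑ i ∈ Finset.range (K N), y i)
          + rankOne ℝ (∑ i ∈ Finset.range (K N), y i) Δ) + (K N : ℝ) • rankOne ℝ Δ Δ := by
    have e : ∀ i, rankOne ℝ ((if i < K N then Δ else 0) + y i) ((if i < K N then Δ else 0) + y i)
        = rankOne ℝ (y i) (y i) + if i < K N then
          rankOne ℝ Δ (y i) + rankOne ℝ (y i) Δ + rankOne ℝ Δ Δ else 0 := by
      intro i
      split_ifs
      · rw [rankOne_self_add]; abel
      · simp
    simp_rw [e]
    rw [Finset.sum_add_distrib, ← Finset.sum_filter, hfilter, Finset.sum_add_distrib,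
      Finset.sum_add_distrib, Finset.sum_const, Finset.card_range, Nat.cast_smul_eq_nsmul,
      map_sum, map_sum, sum_apply]
    abel
  rw [kernelOp_segmentScatter, hsum, hsq, Finset.card_range]
  ext1 z
  simp only [Function.comp, add_apply, sub_apply, smul_apply, rankOne_apply, inner_add_left,
    inner_smul_left, conj_trivial]
  match_scalars <;> field_simp

/-- Uniform closeness of the covariance estimators and of the contrasts to their limits. -/
theorem eventually_estimators_close {y : ℕ → L2I} {C : L2I →L[ℝ] L2I} {σ : ℝ}
    (hθ : θ ∈ Set.Ioo (0 : ℝ) 1) (μ₁ μ₂ : L2I)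
    (h : Tendsto (fun n : ℕ => (n : ℝ)⁻¹ • ∑ i ∈ Finset.range n, y i) atTop (𝓝 0))
    (hσ : Tendsto (fun n : ℕ => (n : ℝ)⁻¹ • ∑ i ∈ Finset.range n, ‖y i‖ ^ 2) atTop (𝓝 σ))
    (hC : Tendsto (fun n : ℕ => (n : ℝ)⁻¹ • ∑ i ∈ Finset.range n, rankOne ℝ (y i) (y i)) atTop
      (𝓝 C)) {δ : ℝ} (hδ : 0 < δ) :
    ∀ᶠ N : ℕ in atTop, ∀ k ∈ Finset.Icc 1 N,
      ‖kernelOp (covEstimator N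
          (fun i => μ₂ + ((if i < ⌊(N : ℝ) * θ⌋₊ then μ₁ - μ₂ else 0) + y i)) ((k : ℝ) / N))
        - limitOp C θ (μ₁ - μ₂) ((k : ℝ) / N)‖ ≤ δ ∧
      ‖contrast N (fun i => μ₂ + ((if i < ⌊(N : ℝ) * θ⌋₊ then μ₁ - μ₂ else 0) + y i)) k
        - driftWeight θ ((k : ℝ) / N) • (μ₁ - μ₂)‖ ≤ δ := by
  set Δ := μ₁ - μ₂
  set K : ℕ → ℕ := fun N => ⌊(N : ℝ) * θ⌋₊ with hKdef
  have hθ' := Set.Ioo_subset_Icc_self hθ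
  have hK : ∀ N, K N ≤ N := fun N => by
    refine Nat.floor_le_of_le ?_
    exact mul_le_of_le_one_right (Nat.cast_nonneg _) hθ.2.le
  have hKlim : Tendsto K atTop atTop :=
    tendsto_nat_floor_atTop.comp (tendsto_natCast_atTop_atTop.atTop_mul_const hθ.1)
  have hKθ : Tendsto (fun N : ℕ => (K N : ℝ) / N) atTop (𝓝 θ) := by
    have := (tendsto_nat_floor_mul_div_atTop hθ.1.le).comp (tendsto_natCast_atTop_atTop (R := ℝ))
    refine this.congr fun n => ?_
    simp [hKdef, mul_comm]
  have hscatter := tendsto_totalScatter hK hKlim hKθ Δ h hC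
  have hev : ∀ B : ℝ, ∃ ε > 0, 2 * ε * B + ε ^ 2 ≤ δ / 3 ∧ ε ≤ δ / 3 := by
    intro B
    have hlim : Tendsto (fun ε : ℝ => 2 * ε * B + ε ^ 2) (𝓝[>] 0) (𝓝 0) := by
      have : Continuous fun ε : ℝ => 2 * ε * B + ε ^ 2 := by fun_prop
      have := this.tendsto 0
      simp only [mul_zero, zero_mul, ne_eq, OfNat.ofNat_ne_zero, not_false_eq_true, zero_pow,
        add_zero] at this
      exact this.mono_left nhdsWithin_le_nhds
    have h3 : 0 < δ / 3 := by positivity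
    obtain ⟨ε, h1, h2⟩ := ((hlim.eventually_le_const h3).and (Ioc_mem_nhdsGT h3)).exists
    exact ⟨ε, h2.1, h1, h2.2⟩
  obtain ⟨ε, hε0, hε1, hε2⟩ := hev ‖Δ‖
  have hθev : ∀ᶠ N : ℕ in atTop, 4 * |(K N : ℝ) / N - θ| * ‖Δ‖ ^ 2 < δ / 3 ∧
      2 * |(K N : ℝ) / N - θ| * ‖Δ‖ < δ / 3 := by
    have h0 : Tendsto (fun N : ℕ => |(K N : ℝ) / N - θ|) atTop (𝓝 0) := by
      have := (hKθ.sub_const θ).abs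
      simpa using this
    have h1 := ((h0.const_mul 4).mul_const (‖Δ‖ ^ 2))
    have h2 := ((h0.const_mul 2).mul_const ‖Δ‖)
    rw [mul_zero, zero_mul] at h1 h2
    exact (h1.eventually_lt_const (by positivity)).and (h2.eventually_lt_const (by positivity))
  have hsev : ∀ᶠ N : ℕ in atTop, ‖(N : ℝ)⁻¹ • kernelOp (segmentScatter (Finset.range N)
      (fun i => (if i < K N then Δ else 0) + y i)) - (C + (θ * (1 - θ)) • rankOne ℝ Δ Δ)‖
      < δ / 3 :=
    (tendsto_iff_norm_sub_tendsto_zero.1 hscatter).eventually_lt_const (by positivity)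
  filter_upwards [eventually_norm_contrast_sq_le h hσ (pow_pos hε0 2), hθev, hsev]
    with N hN1 hN2 hN3 k hk
  have hq := div_mem_Ioc hk
  have hq' := Set.Ioc_subset_Icc_self hq
  have hR := hN1 k hk
  have hkN := Finset.mem_Icc.1 hk
  have hN0 : (0 : ℝ) < N := by exact_mod_cast (show 0 < N by omega)
  have hKN : (K N : ℝ) / N ∈ Set.Icc (0 : ℝ) 1 :=
    ⟨by positivity, (div_le_one hN0).2 (by exact_mod_cast hK N)⟩
  have hRε : ‖contrast N y k‖ ≤ ε := by
    refine (sq_le_sq₀ (norm_nonneg _) hε0.le).1 (hR.trans ?_)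
    refine mul_le_of_le_one_right (sq_nonneg _) ?_
    nlinarith [hq'.1, hq'.2]
  constructor
  · rw [kernelOp_covEstimator hk, segmentScatter_const_add, contrast_change hk (hK N), limitOp,
      changeWeight_eq_sub hθ hq]
    have hpert := norm_rankOne_perturbation_le hθ' hKN hq hε0.le Δ (contrast N y k) hR
    refine (le_trans (le_of_eq ?_) (norm_sub_le _ _)).trans
      ((add_le_add hN3.le hpert).trans (by linarith [hN2.1]))
    congr 1
    module
  · rw [contrast_change hk (hK N), add_sub_right_comm, ← sub_smul]
    refine (norm_add_le _ _).trans ?_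
    rw [norm_smul, Real.norm_eq_abs]
    have := mul_le_mul_of_nonneg_right (abs_driftWeight_sub_le (θ := θ) (θ' := (K N : ℝ) / N) hq')
      (norm_nonneg Δ)
    linarith [hN2.2]

end Estimator

/-! ### Compactness and symmetry of the estimated operators; rewriting the statistic. -/

theorem isCompactOperator_sum {E ι : Type*} [NormedAddCommGroup E] [NormedSpace ℝ E] (s : Finset ι)
    (f : ι → E →L[ℝ] E) (h : ∀ i ∈ s, IsCompactOperator (f i)) :
    IsCompactOperator (∑ i ∈ s, f i : E →L[ℝ] E) :=
  (compactOperator (RingHom.id ℝ) E E).sum_mem (t := s) (f := f) h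

theorem isCompactOperator_kernelOp_segmentScatter (s : Finset ℕ) (x : ℕ → L2I) :
    IsCompactOperator (kernelOp (segmentScatter s x)) := by
  rw [segmentScatter, map_sum]
  refine isCompactOperator_sum _ _ fun i _ => ?_
  rw [kernelOp_tensorKernel]
  exact isCompactOperator_rankOne _ _

theorem isSymmetric_sum {E ι : Type*} [NormedAddCommGroup E] [InnerProductSpace ℝ E] (s : Finset ι)
    (f : ι → E →L[ℝ] E) (h : ∀ i ∈ s, (f i : E →ₗ[ℝ] E).IsSymmetric) :
    ((∑ i ∈ s, f i : E →L[ℝ] E) : E →ₗ[ℝ] E).IsSymmetric := by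
  intro x y
  simp only [ContinuousLinearMap.coe_coe, sum_apply, sum_inner, inner_sum]
  exact Finset.sum_congr rfl fun i hi => h i hi x y

theorem isSymmetric_kernelOp_segmentScatter (s : Finset ℕ) (x : ℕ → L2I) :
    (kernelOp (segmentScatter s x) : L2I →ₗ[ℝ] L2I).IsSymmetric := by
  rw [segmentScatter, map_sum]
  refine isSymmetric_sum _ _ fun i _ => ?_
  rw [kernelOp_tensorKernel]
  exact isSymmetric_rankOne_self _

theorem isCompactOperator_kernelOp_covEstimator (N : ℕ) (x : ℕ → L2I) (u : ℝ) :
    IsCompactOperator (kernelOp (covEstimator N x u)) := by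
  rw [covEstimator, map_smul, map_add]
  exact ((isCompactOperator_kernelOp_segmentScatter _ _).add
    (isCompactOperator_kernelOp_segmentScatter _ _)).smul (N : ℝ)⁻¹

theorem isSymmetric_kernelOp_covEstimator (N : ℕ) (x : ℕ → L2I) (u : ℝ) :
    (kernelOp (covEstimator N x u) : L2I →ₗ[ℝ] L2I).IsSymmetric := by
  rw [covEstimator, map_smul, map_add]
  exact ((isSymmetric_kernelOp_segmentScatter _ _).add
    (isSymmetric_kernelOp_segmentScatter _ _)).smul (by simp)

theorem kernelOp_limitKernel (c : L2II) (θ : ℝ) (Δ : L2I) (u : ℝ) :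
    kernelOp (limitKernel c θ Δ u) = limitOp (kernelOp c) θ Δ u := by
  rw [limitKernel, limitOp, map_add, map_smul, kernelOp_tensorKernel]

theorem score_eq_inner (x v : L2I) : score x v = inner ℝ x v :=
  (L2I.inner_eq_integral x v).symm

theorem driftCoeff_eq (θ u : ℝ) (Δ w : L2I) :
    driftCoeff θ u Δ w = driftWeight θ u * inner ℝ Δ w := by
  rw [driftCoeff, driftWeight, L2I.inner_eq_integral]

theorem testStat_div {d : ℕ} (N : ℕ) (x : ℕ → L2I) (lamHat : ℝ → Fin d → ℝ)
    (vHat : ℝ → Fin d → L2I) :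
    1 / (N : ℝ) * testStat N x lamHat vHat
      = 1 / (N : ℝ) * ∑ l, ∑ k ∈ Finset.Icc 1 N,
        inner ℝ (contrast N x k) (vHat ((k : ℝ) / N) l) ^ 2 / lamHat ((k : ℝ) / N) l := by
  rw [testStat]
  congr 1
  rw [Finset.mul_sum]
  refine Finset.sum_congr rfl fun l _ => ?_
  rw [Finset.mul_sum]
  refine Finset.sum_congr rfl fun k _ => ?_
  simp_rw [score_eq_inner]
  rw [contrast, inner_smul_left, inner_sub_left, inner_smul_left, sum_inner, sum_inner, conj_trivial,
    conj_trivial, mul_pow, inv_pow]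
  ring

/-! ### Strong laws and the probability of a deviation. -/

section Probability

variable {Ω : Type*} [MeasurableSpace Ω] {P : Measure Ω}

theorem tendsto_measure_of_ae_eventually_notMem [IsFiniteMeasure P] {A : ℕ → Set Ω}
    (hA : ∀ n, NullMeasurableSet (A n) P) (h : ∀ᵐ ω ∂P, ∀ᶠ n in atTop, ω ∉ A n) :
    Tendsto (fun n => P (A n)) atTop (𝓝 0) := by
  have h1 : TendstoInMeasure P (fun n => (A n).indicator (fun _ => (1 : ℝ))) atTop 0 := by
    refine tendstoInMeasure_of_tendsto_ae
      (fun n => aestronglyMeasurable_const.indicator₀ (hA n)) ?_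
    filter_upwards [h] with ω hω
    refine tendsto_const_nhds.congr' ?_
    filter_upwards [hω] with n hn
    simp [hn]
  have h2 := (tendstoInMeasure_iff_norm.1 h1) 1 one_pos
  refine h2.congr fun n => ?_
  congr 1
  ext ω
  by_cases hω : ω ∈ A n <;> simp [hω]

theorem aestronglyMeasurable_segmentScatter {x : Ω → ℕ → L2I}
    (hx : ∀ i, AEStronglyMeasurable (fun ω => x ω i) P) (s : Finset ℕ) :
    AEStronglyMeasurable (fun ω => segmentScatter s (x ω)) P := by
  have hsum : AEStronglyMeasurable (fun ω => ∑ i ∈ s, x ω i) P :=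
    Finset.aestronglyMeasurable_fun_sum s fun i _ => hx i
  unfold segmentScatter segmentMean
  exact Finset.aestronglyMeasurable_fun_sum s fun i _ =>
    continuous_tensorKernel_self.comp_aestronglyMeasurable ((hx i).sub (hsum.fun_const_smul _))

theorem aestronglyMeasurable_covEstimator {x : Ω → ℕ → L2I}
    (hx : ∀ i, AEStronglyMeasurable (fun ω => x ω i) P) (N : ℕ) (u : ℝ) :
    AEStronglyMeasurable (fun ω => covEstimator N (x ω) u) P :=
  ((aestronglyMeasurable_segmentScatter hx _).add
    (aestronglyMeasurable_segmentScatter hx _)).const_smul (N : ℝ)⁻¹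

theorem aestronglyMeasurable_contrast {x : Ω → ℕ → L2I}
    (hx : ∀ i, AEStronglyMeasurable (fun ω => x ω i) P) (N k : ℕ) :
    AEStronglyMeasurable (fun ω => contrast N (x ω) k) P := by
  have hsum : ∀ s : Finset ℕ, AEStronglyMeasurable (fun ω => ∑ i ∈ s, x ω i) P :=
    fun s => Finset.aestronglyMeasurable_fun_sum s fun i _ => hx i
  exact ((hsum _).sub ((hsum _).const_smul ((k : ℝ) / N))).const_smul (N : ℝ)⁻¹

variable [MeasurableSpace L2I] [BorelSpace L2I] {Y : ℕ → Ω → L2I}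

theorem aestronglyMeasurable_sample (hident : ∀ i, IdentDistrib (Y i) (Y 0) P P)
    (hsq : MemLp (Y 0) 2 P) (θ : ℝ) (μ₁ μ₂ : L2I) (N i : ℕ) :
    AEStronglyMeasurable (fun ω => changeSample θ μ₁ μ₂ Y N ω i) P :=
  ((hident i).symm.aestronglyMeasurable_snd hsq.1).const_add _

variable [IsProbabilityMeasure P]

/-- The third law is applied to `Y i ⊗ Y i` in the separable space of kernels; continuity of
`kernelOp` carries it to operator norm. -/
theorem ae_tendsto_averages (hindep : iIndepFun Y P) (hident : ∀ i, IdentDistrib (Y i) (Y 0) P P)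
    (hsq : MemLp (Y 0) 2 P) (hmean : ∫ ω, Y 0 ω ∂P = 0) :
    ∀ᵐ ω ∂P,
      Tendsto (fun n : ℕ => (n : ℝ)⁻¹ • ∑ i ∈ Finset.range n, Y i ω) atTop (𝓝 0) ∧
      Tendsto (fun n : ℕ => (n : ℝ)⁻¹ • ∑ i ∈ Finset.range n, ‖Y i ω‖ ^ 2) atTop
        (𝓝 (∫ ω, ‖Y 0 ω‖ ^ 2 ∂P)) ∧
      Tendsto (fun n : ℕ => (n : ℝ)⁻¹ • ∑ i ∈ Finset.range n, rankOne ℝ (Y i ω) (Y i ω)) atTop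
        (𝓝 (kernelOp (covKernel P (Y 0)))) := by
  let _ : MeasurableSpace L2II := borel L2II
  have : BorelSpace L2II := ⟨rfl⟩
  have hpair : ∀ ⦃i j⦄, i ≠ j → IndepFun (Y i) (Y j) P := fun i j hij => hindep.indepFun hij
  have hsqint : Integrable (fun ω => ‖Y 0 ω‖ ^ 2) P := hsq.integrable_norm_pow two_ne_zero
  have hmt : Measurable fun x : L2I => tensorKernel x x := continuous_tensorKernel_self.measurable
  have hmn : Measurable fun x : L2I => ‖x‖ ^ 2 := by fun_prop
  have h1 := strong_law_ae Y (hsq.integrable (by norm_num)) (fun i j hij => hpair hij) hident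
  have h2 := strong_law_ae (fun i ω => ‖Y i ω‖ ^ 2) hsqint
    (fun i j hij => (hpair hij).comp hmn hmn) (fun i => (hident i).comp hmn)
  have htint : Integrable (fun ω => tensorKernel (Y 0 ω) (Y 0 ω)) P := by
    refine hsqint.mono' (continuous_tensorKernel_self.comp_aestronglyMeasurable hsq.1) ?_
    exact Eventually.of_forall fun ω => by rw [norm_tensorKernel, sq]
  have h3 := strong_law_ae (fun i ω => tensorKernel (Y i ω) (Y i ω)) htint
    (fun i j hij => (hpair hij).comp hmt hmt) (fun i => (hident i).comp hmt)
  filter_upwards [h1, h2, h3] with ω g1 g2 g3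
  refine ⟨by rwa [hmean] at g1, g2, ?_⟩
  have := (kernelOp.continuous.tendsto _).comp g3
  refine this.congr fun n => ?_
  simp [Function.comp, map_sum, kernelOp_tensorKernel]

/-- The samples for which some estimator or contrast is further than `δ` from its limit. -/
def deviationSet (P : Measure Ω) (θ : ℝ) (μ₁ μ₂ : L2I) (Y : ℕ → Ω → L2I) (δ : ℝ) (N : ℕ) : Set Ω :=
  ⋃ k ∈ Finset.Icc 1 N,
    {ω | δ < ‖kernelOp (covEstimator N (changeSample θ μ₁ μ₂ Y N ω) ((k : ℝ) / N))
        - limitOp (kernelOp (covKernel P (Y 0))) θ (μ₁ - μ₂) ((k : ℝ) / N)‖} ∪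
    {ω | δ < ‖contrast N (changeSample θ μ₁ μ₂ Y N ω) k
        - driftWeight θ ((k : ℝ) / N) • (μ₁ - μ₂)‖}

theorem tendsto_measure_deviationSet (hindep : iIndepFun Y P)
    (hident : ∀ i, IdentDistrib (Y i) (Y 0) P P)
    (hsq : MemLp (Y 0) 2 P) (hmean : ∫ ω, Y 0 ω ∂P = 0) {θ : ℝ} (hθ : θ ∈ Set.Ioo (0 : ℝ) 1)
    (μ₁ μ₂ : L2I) {δ : ℝ} (hδ : 0 < δ) :
    Tendsto (fun N => P (deviationSet P θ μ₁ μ₂ Y δ N)) atTop (𝓝 0) := by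
  refine tendsto_measure_of_ae_eventually_notMem (fun N => ?_) ?_
  -- The event is built from kernels and contrasts only, so it is null measurable whatever
  -- eigenfunctions are chosen.
  · have hx := aestronglyMeasurable_sample (P := P) hident hsq θ μ₁ μ₂ N
    refine Finset.nullMeasurableSet_biUnion _ fun k _ => NullMeasurableSet.union ?_ ?_
    · refine nullMeasurableSet_lt aemeasurable_const (AEStronglyMeasurable.aemeasurable ?_)
      exact ((kernelOp.continuous.comp_aestronglyMeasurable
        (aestronglyMeasurable_covEstimator hx N _)).sub aestronglyMeasurable_const).norm
    · refine nullMeasurableSet_lt aemeasurable_const (AEStronglyMeasurable.aemeasurable ?_)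
      exact ((aestronglyMeasurable_contrast hx N k).sub aestronglyMeasurable_const).norm
  · filter_upwards [ae_tendsto_averages hindep hident hsq hmean] with ω ⟨h1, h2, h3⟩
    filter_upwards [eventually_estimators_close hθ μ₁ μ₂ h1 h2 h3 hδ] with N hN hmem
    simp only [deviationSet, Set.mem_iUnion] at hmem
    obtain ⟨k, hk, h⟩ := hmem
    obtain ⟨g1, g2⟩ := hN k hk
    rw [← changeSample_eq θ μ₁ μ₂ Y N ω] at g1 g2
    rcases h with h | h
    · exact absurd g1 (not_le.2 h)
    · exact absurd g2 (not_le.2 h)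

/-- Along a single typical sample path the operator is a norm limit of symmetric operators of finite
rank. -/
theorem isCompactOperator_and_isSymmetric_kernelOp_covKernel (hindep : iIndepFun Y P)
    (hident : ∀ i, IdentDistrib (Y i) (Y 0) P P)
    (hsq : MemLp (Y 0) 2 P) (hmean : ∫ ω, Y 0 ω ∂P = 0) :
    IsCompactOperator (kernelOp (covKernel P (Y 0))) ∧
      (kernelOp (covKernel P (Y 0)) : L2I →ₗ[ℝ] L2I).IsSymmetric := by
  obtain ⟨ω, -, -, h⟩ := (ae_tendsto_averages hindep hident hsq hmean).exists
  constructor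
  · exact isCompactOperator_of_tendsto h (Eventually.of_forall fun n =>
      (isCompactOperator_sum _ _ fun i _ => isCompactOperator_rankOne _ _).smul (n : ℝ)⁻¹)
  · intro x y
    have hx : ∀ z, Tendsto (fun n : ℕ =>
        ((n : ℝ)⁻¹ • ∑ i ∈ Finset.range n, rankOne ℝ (Y i ω) (Y i ω)) z) atTop
        (𝓝 (kernelOp (covKernel P (Y 0)) z)) := fun z =>
      ((ContinuousLinearMap.apply ℝ L2I z).continuous.tendsto _).comp h
    refine tendsto_nhds_unique ((hx x).inner (tendsto_const_nhds (x := y)))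
      (((tendsto_const_nhds (x := x)).inner (hx y)).congr fun n => ?_)
    exact (((isSymmetric_sum (Finset.range n) _ fun i _ =>
      isSymmetric_rankOne_self (𝕜 := ℝ) (Y i ω)).smul (c := (n : ℝ)⁻¹) (by simp)) x y).symm

end Probability

/-- Serves the separability of `L2I`, on which the countability of exceptional parameters rests. -/
instance : Fact ((2 : ENNReal) ≠ ⊤) := ⟨ENNReal.ofNat_ne_top⟩
end

/-! ### Assembly. -/

theorem theorem3
    {Ω : Type*} [MeasurableSpace Ω] (P : Measure Ω) [IsProbabilityMeasure P]
    [MeasurableSpace L2I] [BorelSpace L2I]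
    -- the errors: i.i.d. centred square-integrable random elements of `L²([0,1])`
    (Y : ℕ → Ω → L2I)
    (hindep : iIndepFun Y P) (hident : ∀ i, IdentDistrib (Y i) (Y 0) P P)
    (hsq : MemLp (Y 0) 2 P) (hmean : ∫ ω, Y 0 ω ∂P = 0)
    -- the single change point
    (θ : ℝ) (hθ : θ ∈ Set.Ioo (0 : ℝ) 1) (μ₁ μ₂ : L2I)
    -- the `d` largest eigenvalues of the covariance kernel `c` are positive
    (d : ℕ) (lam : Fin d → ℝ) (v : Fin d → L2I)
    (hlam : IsLeadingEigensystem (covKernel P (Y 0)) lam v) (hpos : ∀ l, 0 < lam l)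
    -- eigenvalues and eigenfunctions of `c_u`
    (γ : ℝ → Fin d → ℝ) (w : ℝ → Fin d → L2I)
    (hw : ∀ u ∈ Set.Ioc (0 : ℝ) 1,
      IsLeadingEigensystem (limitKernel (covKernel P (Y 0)) θ (μ₁ - μ₂) u) (γ u) (w u))
    -- eigenvalues and eigenfunctions of the estimator of `c_u`
    (lamHat : ℕ → Ω → ℝ → Fin d → ℝ) (vHat : ℕ → Ω → ℝ → Fin d → L2I)
    (hHat : ∀ (N : ℕ) (ω : Ω), ∀ u ∈ Set.Ioc (0 : ℝ) 1,
      IsLeadingEigensystem (covEstimator N (changeSample θ μ₁ μ₂ Y N ω) u)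
        (lamHat N ω u) (vHat N ω u)) :
    (∀ l, IntervalIntegrable (fun u => driftCoeff θ u (μ₁ - μ₂) (w u l) ^ 2 / γ u l)
      volume 0 1) ∧
    TendstoInMeasure P
      (fun (N : ℕ) ω => 1 / (N : ℝ) *
        testStat N (changeSample θ μ₁ μ₂ Y N ω) (lamHat N ω) (vHat N ω))
      atTop
      (fun _ => ∑ l, ∫ u in (0 : ℝ)..1, driftCoeff θ u (μ₁ - μ₂) (w u l) ^ 2 / γ u l) ∧
    (0 < ∑ l, ∫ u in (0 : ℝ)..1, driftCoeff θ u (μ₁ - μ₂) (w u l) ^ 2 / γ u l →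
      ∀ M : ℝ, Tendsto
        (fun N : ℕ =>
          P {ω | testStat N (changeSample θ μ₁ μ₂ Y N ω) (lamHat N ω) (vHat N ω) ≤ M})
        atTop (𝓝 0)) := by
  obtain ⟨hC, hCs⟩ := isCompactOperator_and_isSymmetric_kernelOp_covKernel hindep hident hsq hmean
  have hlam' := hlam.hasLeadingEigensystem
  have hw' : ∀ u ∈ Set.Ioc (0 : ℝ) 1, HasLeadingEigensystem
      (limitOp (kernelOp (covKernel P (Y 0))) θ (μ₁ - μ₂) u) (γ u) (w u) := fun u hu => by
    rw [← kernelOp_limitKernel]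
    exact (hw u hu).hasLeadingEigensystem
  simp_rw [driftCoeff_eq]
  set L := ∑ l, ∫ u in (0 : ℝ)..1, (driftWeight θ u * inner ℝ (μ₁ - μ₂) (w u l)) ^ 2 / γ u l with hL
  -- The statistic may fail to be measurable, so its deviation event is only bounded, through
  -- monotonicity of the outer measure, by the deviation event of the estimators.
  have hsub : ∀ ε > 0, ∃ δ > 0, ∃ N₀ : ℕ, ∀ N ≥ N₀,
      {ω | ε ≤ |1 / (N : ℝ) * testStat N (changeSample θ μ₁ μ₂ Y N ω) (lamHat N ω) (vHat N ω) - L|}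
        ⊆ deviationSet P θ μ₁ μ₂ Y δ N := by
    intro ε hε
    obtain ⟨δ, hδ, N₀, hN₀⟩ := exists_uniform_average_close hC hCs hθ hlam' hpos hw' hε
    refine ⟨δ, hδ, N₀, fun N hN ω hω => ?_⟩
    by_contra hnot
    simp only [deviationSet, Set.mem_iUnion, Set.mem_union, Set.mem_ofPred_eq, not_exists, not_or,
      not_lt] at hnot
    have := hN₀ N hN
      (fun k => kernelOp (covEstimator N (changeSample θ μ₁ μ₂ Y N ω) ((k : ℝ) / N)))
      (fun k => contrast N (changeSample θ μ₁ μ₂ Y N ω) k)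
      (fun k => lamHat N ω ((k : ℝ) / N)) (fun k => vHat N ω ((k : ℝ) / N))
      (fun k _ => isCompactOperator_kernelOp_covEstimator _ _ _)
      (fun k _ => isSymmetric_kernelOp_covEstimator _ _ _)
      (fun k hk => (hHat N ω _ (div_mem_Ioc hk)).hasLeadingEigensystem)
      (fun k hk => (hnot k hk).1) (fun k hk => (hnot k hk).2)
    rw [← testStat_div] at this
    exact absurd this (not_lt.2 hω)
  have hlim : ∀ ε > 0, Tendsto (fun N : ℕ => P {ω | ε ≤ |1 / (N : ℝ) *
      testStat N (changeSample θ μ₁ μ₂ Y N ω) (lamHat N ω) (vHat N ω) - L|}) atTop (𝓝 0) := by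
    intro ε hε
    obtain ⟨δ, hδ, N₀, hN₀⟩ := hsub ε hε
    refine tendsto_of_tendsto_of_tendsto_of_le_of_le' tendsto_const_nhds
      (tendsto_measure_deviationSet hindep hident hsq hmean hθ μ₁ μ₂ hδ)
      (Eventually.of_forall fun _ => zero_le) ?_
    filter_upwards [eventually_ge_atTop N₀] with N hN
    exact measure_mono (hN₀ N hN)
  refine ⟨fun l => intervalIntegrable_limit hC hCs hθ hlam' hpos hw' l, ?_, fun hLpos M => ?_⟩
  · rw [tendstoInMeasure_iff_norm]
    exact hlim
  · refine tendsto_of_tendsto_of_tendsto_of_le_of_le' tendsto_const_nhds (hlim (L / 2) (by positivity))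
      (Eventually.of_forall fun _ => zero_le) ?_
    -- For such `N`, a statistic at most `M` has normalized value at most `L / 2`, hence a deviation
    -- of at least `L / 2` from `L`.
    have hN : ∀ᶠ N : ℕ in atTop, M ≤ L / 2 * N :=
      (tendsto_natCast_atTop_atTop.const_mul_atTop (half_pos hLpos)).eventually_ge_atTop _
    filter_upwards [hN, eventually_gt_atTop 0] with N hN hN0
    refine measure_mono fun ω hω => ?_
    have hN0' : (0 : ℝ) < N := by exact_mod_cast hN0
    have h1 : 1 / (N : ℝ) * testStat N (changeSample θ μ₁ μ₂ Y N ω) (lamHat N ω) (vHat N ω)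
        ≤ L / 2 := by
      rw [one_div, inv_mul_le_iff₀ hN0', mul_comm]
      exact le_trans hω hN
    show L / 2 ≤ |_|
    rw [abs_sub_comm]
    exact le_trans (by linarith) (le_abs_self _)
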